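/- Let $G$ be a noncompact connected (real, finite-dimensional) semisimple Lie group with Lie algebra $\mathfrak g$ and Killing form $B$, and let $\Theta : G \to G$ be a Cartan involution of $G$, that is, an involutive smooth automorphism whose differential $\theta = d\Theta$ at the identity is a Cartan involution of $\mathfrak g$ (an involutive Lie algebra automorphism such that $-B(X,\theta Y)$ is positive definite). Let $K = \{g \in G : \Theta(g) = g\}$, let $\mathfrak p$ be the $(-1)$-eigenspace of $\theta$, and let $P = \exp \mathfrak p$, identified with the symmetric space $G/K$ of noncompact type. The map $\exp : \mathfrak p \to P$ is a bijection; for $p = \exp X \in P$ with $X \in \mathfrak p$ and $r \in \mathbb R$, put $p^r = \exp(rX)$. For $p, q \in P$ and $t \in [0,1]$ define $$p \sharp_t q = p^{1/2}\left(p^{-1/2} q p^{-1/2}\right)^t p^{1/2}, \qquad p \sharp q = p \sharp_{1/2} q, \qquad p \natural_t q = (p^{-1} \sharp q)^t\, p\, (p^{-1} \sharp q)^t ,$$ which are elements of $P$. Then for all $p, q \in P$ and $t \in [0,1]$ there is $k_t \in K$ such that $p \sharp q$ is $P$-conjugate to $(q \natural_t p)^{1/2}\, k_t\, (p \natural_t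 q)^{1/2}$; that is, there is $c \in P$ with $$p \sharp q = c\,(q \natural_t p)^{1/2}\, k_t\, (p \natural_t q)^{1/2}\, c^{-1}.$$ -/

import Mathlib

open scoped Manifold ContDiff

/-- Over `ℝ`, a smooth Lie group is regular enough to carry Mathlib's Lie bracket on its tangent
space at the identity. -/
instance lieGroup_minSmoothness_three (E : Type*) [NormedAddCommGroup E] [NormedSpace ℝ E]
    (G : Type*) [TopologicalSpace G] [ChartedSpace E G] [Group G] [LieGroup 𝓘(ℝ, E) ∞ G] :
    LieGroup 𝓘(ℝ, E) (minSmoothness ℝ 3) G :=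
  LieGroup.of_le (n := ∞) (by
    rw [minSmoothness_of_isRCLikeNormedField]
    exact ENat.LEInfty.out)

noncomputable section SymmetricSpace

/-- A Cartan involution of a real Lie algebra `L`: an involutive Lie algebra automorphism `θ` such
that `B_θ(X, Y) = -B(X, θ Y)` is positive definite, where `B` is the Killing form. -/
structure IsCartanInvolution {L : Type*} [LieRing L] [LieAlgebra ℝ L] (θ : L →ₗ[ℝ] L) : Prop where
  map_lie : ∀ X Y : L, θ ⁅X, Y⁆ = ⁅θ X, θ Y⁆
  involutive : ∀ X : L, θ (θ X) = X
  pos : ∀ X : L, X ≠ 0 → 0 < -(killingForm ℝ L X (θ X))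

variable {E : Type*} [NormedAddCommGroup E] [NormedSpace ℝ E]
  {G : Type*} [TopologicalSpace G] [ChartedSpace E G] [Group G]

/-- The differential at the identity of an endomorphism of a Lie group, as a linear endomorphism of
the Lie algebra (the value of the endomorphism at `1` is `1`). -/
def lieDifferential (E : Type*) [NormedAddCommGroup E] [NormedSpace ℝ E]
    {G : Type*} [TopologicalSpace G] [ChartedSpace E G] [Group G] (Φ : G →* G) :
    GroupLieAlgebra 𝓘(ℝ, E) G →ₗ[ℝ] GroupLieAlgebra 𝓘(ℝ, E) G where
  toFun X := (mfderiv 𝓘(ℝ, E) 𝓘(ℝ, E) Φ (1 : G) X : TangentSpace 𝓘(ℝ, E) (Φ 1))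
  map_add' X Y := map_add (mfderiv 𝓘(ℝ, E) 𝓘(ℝ, E) Φ (1 : G)) X Y
  map_smul' c X := map_smul (mfderiv 𝓘(ℝ, E) 𝓘(ℝ, E) Φ (1 : G)) c X

/-- A (global) Cartan involution of a Lie group: an involutive smooth automorphism whose
differential is a Cartan involution of the Lie algebra. -/
structure IsGroupCartanInvolution (E : Type*) [NormedAddCommGroup E] [NormedSpace ℝ E]
    [CompleteSpace E] {G : Type*} [TopologicalSpace G] [ChartedSpace E G] [Group G]
    [LieGroup 𝓘(ℝ, E) ∞ G] (Θ : G →* G) : Prop where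
  smooth : ContMDiff 𝓘(ℝ, E) 𝓘(ℝ, E) ∞ Θ
  involutive : ∀ g : G, Θ (Θ g) = g
  differential : IsCartanInvolution (lieDifferential E Θ)

open Classical in
/-- The exponential map of a Lie group: `exp X = γ 1`, where `γ` is the integral curve through the
identity of the left-invariant vector field determined by `X` (it always exists and is unique). -/
def lieExp (X : GroupLieAlgebra 𝓘(ℝ, E) G) : G :=
  if h : ∃ γ : ℝ → G, γ 0 = 1 ∧ IsMIntegralCurve (I := 𝓘(ℝ, E)) γ (mulInvariantVectorField X)
  then h.choose 1 else 1

variable (E)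

/-- The fixed point subgroup `K` of `Θ`. -/
def fixedSubgroup {G : Type*} [Group G] (Θ : G →* G) : Subgroup G :=
  Θ.eqLocus (MonoidHom.id G)

/-- The `-1` eigenspace `𝔭` of the differential of `Θ`. -/
def cartanSubspace (Θ : G →* G) : Submodule ℝ (GroupLieAlgebra 𝓘(ℝ, E) G) :=
  Module.End.eigenspace (lieDifferential E Θ) (-1)

/-- `P = exp 𝔭`. -/
def symmetricSpaceP (Θ : G →* G) : Set G :=
  {g | ∃ X ∈ cartanSubspace E Θ, lieExp X = g}

/-- The logarithm of a point of `P`: the element `X` of `𝔭` with `exp X = p`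
(it is unique when `Θ` is a Cartan involution; the value is meaningless for `p ∉ P`). -/
def logP (Θ : G →* G) (p : G) : GroupLieAlgebra 𝓘(ℝ, E) G :=
  Function.invFunOn (lieExp (E := E) (G := G)) (cartanSubspace E Θ) p

/-- The real powers `p ^ r = exp (r log p)` of a point of `P`. -/
def powP (Θ : G →* G) (p : G) (r : ℝ) : G :=
  lieExp (r • logP E Θ p)

/-- The `t`-geometric mean `p ♯_t q = p^{1/2} (p^{-1/2} q p^{-1/2})^t p^{1/2}`. -/
def geometricMean (Θ : G →* G) (t : ℝ) (p q : G) : G :=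
  powP E Θ p (1 / 2) *
    powP E Θ (powP E Θ p (-(1 / 2)) * q * powP E Θ p (-(1 / 2))) t *
    powP E Θ p (1 / 2)

/-- The `t`-spectral mean `p ♮_t q = (p⁻¹ ♯ q)^t p (p⁻¹ ♯ q)^t`, where `♯ = ♯_{1/2}`. -/
def spectralMean (Θ : G →* G) (t : ℝ) (p q : G) : G :=
  powP E Θ (geometricMean E Θ (1 / 2) p⁻¹ q) t * p *
    powP E Θ (geometricMean E Θ (1 / 2) p⁻¹ q) t

/-- `x` is `P`-conjugate to `y`: `x = c y c⁻¹` for some `c ∈ P`. -/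
def IsPConjugate (Θ : G →* G) (x y : G) : Prop :=
  ∃ c ∈ symmetricSpaceP E Θ, x = c * y * c⁻¹

end SymmetricSpace

/-! ### Left-invariant fields and the exponential map -/

section LieExponential

open Set Filter Topology

variable {E : Type*} [NormedAddCommGroup E] [NormedSpace ℝ E]
  {G : Type*} [TopologicalSpace G] [ChartedSpace E G] [Group G] [LieGroup 𝓘(ℝ, E) ∞ G]

/-! The final computation is short. Put `s = p⁻¹ ♯ q` and `m = p ♯ q`; these solve the Riccati
equations `s p s = q` and `m p⁻¹ m = q`. Uniqueness of such solutions in `P` gives `q⁻¹ ♯ p = s⁻¹`,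
so with `c = s^t` the two spectral means are `c p c = a²` and `c⁻¹ q c⁻¹ = b²`, where `a, b ∈ P`.
The element `k = b⁻¹ c⁻¹ m c a⁻¹` satisfies `m = c b k a c⁻¹` by construction. Since `Θ` inverts
`P`, the equation `Θ k = k` follows from the formulas for `a²` and `b²` and from `m p⁻¹ m = q`.

All this needs `P` to behave like positive definite matrices: `exp` is injective on `𝔭`, and `p q p
∈ P` for `p, q ∈ P` (`mul_mul_mem`). Both are read off from the adjoint representation, where `Ad
(exp X) = e^{ad X}` (`adjointRep_lieExp`). For `X ∈ 𝔭` the operator `ad X` is symmetric for `B_θ`,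
hence diagonalizable, and `e^{ad X}` determines `X`. Conversely a positive symmetric automorphism is
`e^{ad Z}` with `Z ∈ 𝔭`: its logarithm is a derivation, hence inner (`exists_isExpAd`).

This settles `p q p ∈ P` only up to the kernel of `Ad`. That kernel is discrete, because the center
of the Lie algebra is trivial, so the discrepancy is constant along the path `exp X * exp (t Y) *
exp X`; it is trivial at `t = 0` (`exists_exp_eq_of_continuous`). -/

theorem mdifferentiableAt_mul_left_lieGroup (g h : G) :
    MDifferentiableAt 𝓘(ℝ, E) 𝓘(ℝ, E) (g * ·) h :=
  (contMDiff_mul_left (I := 𝓘(ℝ, E)) (n := ∞) (a := g)).mdifferentiableAt (by simp)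

theorem contMDiff_mulInvariantVectorField_one (X : GroupLieAlgebra 𝓘(ℝ, E) G) :
    ContMDiff 𝓘(ℝ, E) 𝓘(ℝ, E).tangent 1
      (fun g : G ↦ (⟨g, mulInvariantVectorField X g⟩ : TangentBundle 𝓘(ℝ, E) G)) :=
  (contMDiff_mulInvariantVectorField X).of_le
    (le_trans (by norm_num) (le_minSmoothness (𝕜 := ℝ) (n := 2)))

/-- The manifold derivative of a self-map, read as an endomorphism of the model space. -/
noncomputable def mfderivModel (E : Type*) [NormedAddCommGroup E] [NormedSpace ℝ E]
    {G : Type*} [TopologicalSpace G] [ChartedSpace E G] (f : G → G) (x : G) : E →L[ℝ] E :=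
  mfderiv 𝓘(ℝ, E) 𝓘(ℝ, E) f x

omit [LieGroup 𝓘(ℝ, E) ∞ G] [Group G] in
theorem mfderivModel_comp {f g : G → G} {x : G}
    (hf : MDifferentiableAt 𝓘(ℝ, E) 𝓘(ℝ, E) f (g x))
    (hg : MDifferentiableAt 𝓘(ℝ, E) 𝓘(ℝ, E) g x) :
    mfderivModel E (f ∘ g) x = (mfderivModel E f (g x)).comp (mfderivModel E g x) :=
  mfderiv_comp x hf hg

theorem mfderivModel_mul_left_apply (X : GroupLieAlgebra 𝓘(ℝ, E) G) (g h : G) :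
    mfderivModel E (g * ·) h (mulInvariantVectorField X h : E) =
      (mulInvariantVectorField X (g * h) : E) := by
  have key : (fun x ↦ g * h * x) = (g * ·) ∘ (h * ·) := by
    ext x; simp [mul_assoc]
  change mfderivModel E (g * ·) h (mfderivModel E (h * ·) 1 X) =
    mfderivModel E (g * h * ·) 1 X
  rw [key, mfderivModel_comp (mdifferentiableAt_mul_left_lieGroup g (h * 1))
    (mdifferentiableAt_mul_left_lieGroup h 1), mul_one]
  rfl

theorem IsMIntegralCurveOn.mul_left {X : GroupLieAlgebra 𝓘(ℝ, E) G} {γ : ℝ → G} {s : Set ℝ}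
    (hγ : IsMIntegralCurveOn (I := 𝓘(ℝ, E)) γ (mulInvariantVectorField X) s) (g : G) :
    IsMIntegralCurveOn (I := 𝓘(ℝ, E)) (fun t ↦ g * γ t) (mulInvariantVectorField X) s := by
  intro t ht
  have h := (mdifferentiableAt_mul_left_lieGroup (E := E) g
    (γ t)).hasMFDerivAt.comp_hasMFDerivWithinAt t (hγ t ht)
  refine h.congr_mfderiv ?_
  ext
  change mfderivModel E (g * ·) (γ t) ((1 : ℝ) • (mulInvariantVectorField X (γ t) : E)) =
    (1 : ℝ) • (mulInvariantVectorField X (g * γ t) : E)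
  rw [one_smul, one_smul, mfderivModel_mul_left_apply]

theorem IsMIntegralCurve.mul_left {X : GroupLieAlgebra 𝓘(ℝ, E) G} {γ : ℝ → G}
    (hγ : IsMIntegralCurve (I := 𝓘(ℝ, E)) γ (mulInvariantVectorField X)) (g : G) :
    IsMIntegralCurve (I := 𝓘(ℝ, E)) (fun t ↦ g * γ t) (mulInvariantVectorField X) := by
  rw [isMIntegralCurve_iff_isMIntegralCurveOn] at *
  exact hγ.mul_left g

theorem mfderivModel_monoidHom_apply {Φ : G →* G}
    (hΦ : ContMDiff 𝓘(ℝ, E) 𝓘(ℝ, E) ∞ Φ) (X : GroupLieAlgebra 𝓘(ℝ, E) G) (g : G) :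
    mfderivModel E Φ g (mulInvariantVectorField X g : E) =
      (mulInvariantVectorField (lieDifferential E Φ X) (Φ g) : E) := by
  have hd : ∀ x, MDifferentiableAt 𝓘(ℝ, E) 𝓘(ℝ, E) Φ x :=
    fun x ↦ hΦ.mdifferentiableAt (by simp)
  have key : Φ ∘ (g * ·) = (Φ g * ·) ∘ Φ := by
    ext x; simp
  have h₁ := mfderivModel_comp (hd (g * 1)) (mdifferentiableAt_mul_left_lieGroup g 1)
  have h₂ := mfderivModel_comp (mdifferentiableAt_mul_left_lieGroup (Φ g) (Φ 1)) (hd 1)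
  rw [key, h₂, mul_one, map_one] at h₁
  exact (congrArg (fun F : E →L[ℝ] E ↦ F X) h₁).symm

theorem IsMIntegralCurve.map_monoidHom {Φ : G →* G}
    (hΦ : ContMDiff 𝓘(ℝ, E) 𝓘(ℝ, E) ∞ Φ) {X : GroupLieAlgebra 𝓘(ℝ, E) G} {γ : ℝ → G}
    (hγ : IsMIntegralCurve (I := 𝓘(ℝ, E)) γ (mulInvariantVectorField X)) :
    IsMIntegralCurve (I := 𝓘(ℝ, E)) (fun t ↦ Φ (γ t))
      (mulInvariantVectorField (lieDifferential E Φ X)) := by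
  intro t
  have h := (hΦ.mdifferentiableAt (x := γ t) (by simp)).hasMFDerivAt.comp t (hγ t)
  refine h.congr_mfderiv ?_
  ext
  change mfderivModel E Φ (γ t) ((1 : ℝ) • (mulInvariantVectorField X (γ t) : E)) =
    (1 : ℝ) • (mulInvariantVectorField (lieDifferential E Φ X) (Φ (γ t)) : E)
  rw [one_smul, one_smul, mfderivModel_monoidHom_apply hΦ]

variable [T2Space G]

/-- Global integral curves with a given initial value are unique, so the choice made in `lieExp` is
immaterial; the factor `t` is absorbed by rescaling time. -/
theorem IsMIntegralCurve.eq_lieExp {X : GroupLieAlgebra 𝓘(ℝ, E) G} {γ : ℝ → G} (h0 : γ 0 = 1)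
    (hγ : IsMIntegralCurve (I := 𝓘(ℝ, E)) γ (mulInvariantVectorField X)) (t : ℝ) :
    γ t = lieExp (t • X) := by
  have key : ∀ {Y : GroupLieAlgebra 𝓘(ℝ, E) G} {δ : ℝ → G}, δ 0 = 1 →
      IsMIntegralCurve (I := 𝓘(ℝ, E)) δ (mulInvariantVectorField Y) → δ 1 = lieExp Y := by
    intro Y δ h0 hδ
    have h : ∃ γ : ℝ → G, γ 0 = 1 ∧
      IsMIntegralCurve (I := 𝓘(ℝ, E)) γ (mulInvariantVectorField Y) := ⟨δ, h0, hδ⟩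
    rw [lieExp, dif_pos h]
    exact congrFun (isMIntegralCurve_Ioo_eq_of_contMDiff_boundaryless (t₀ := 0)
      (contMDiff_mulInvariantVectorField_one Y) hδ h.choose_spec.2
      (h0.trans h.choose_spec.1.symm)) 1
  have h := key (Y := t • X) (δ := γ ∘ (· * t)) (by simp [h0]) (by
    rw [mulInvariantVectorField_smul]
    exact hγ.comp_mul t)
  simpa using h

variable [CompleteSpace E]

/-- Left translates of the local integral curve at `1` exist on the same interval `(-ε, ε)` at every
point; a uniform existence time makes the field complete. -/
theorem exists_isMIntegralCurve_mulInvariantVectorField (X : GroupLieAlgebra 𝓘(ℝ, E) G) :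
    ∃ γ : ℝ → G, γ 0 = 1 ∧ IsMIntegralCurve (I := 𝓘(ℝ, E)) γ (mulInvariantVectorField X) := by
  obtain ⟨γ, hγ0, hγ⟩ := exists_isMIntegralCurveAt_of_contMDiffAt_boundaryless (I := 𝓘(ℝ, E))
    (0 : ℝ) (contMDiff_mulInvariantVectorField_one X).contMDiffAt (x₀ := (1 : G))
  obtain ⟨ε, hε, hγ⟩ := isMIntegralCurveAt_iff'.1 hγ
  refine exists_isMIntegralCurve_of_isMIntegralCurveOn
    (contMDiff_mulInvariantVectorField_one X) hε (fun x ↦ ⟨fun t ↦ x * γ t, by simp [hγ0], ?_⟩) 1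
  have := hγ.mul_left x
  rwa [Real.ball_eq_Ioo, zero_sub, zero_add] at this

theorem isMIntegralCurve_lieExp (X : GroupLieAlgebra 𝓘(ℝ, E) G) :
    IsMIntegralCurve (I := 𝓘(ℝ, E)) (fun t : ℝ ↦ lieExp (G := G) (t • X))
      (mulInvariantVectorField X) := by
  obtain ⟨γ, h0, hγ⟩ := exists_isMIntegralCurve_mulInvariantVectorField X
  rwa [← funext (hγ.eq_lieExp h0)]

theorem lieExp_zero : lieExp (0 : GroupLieAlgebra 𝓘(ℝ, E) G) = 1 := by
  obtain ⟨γ, h0, hγ⟩ := exists_isMIntegralCurve_mulInvariantVectorField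
    (0 : GroupLieAlgebra 𝓘(ℝ, E) G)
  have := hγ.eq_lieExp h0 0
  rw [h0, zero_smul] at this
  exact this.symm

theorem continuous_lieExp_smul (X : GroupLieAlgebra 𝓘(ℝ, E) G) :
    Continuous fun t : ℝ ↦ lieExp (G := G) (t • X) :=
  continuous_iff_continuousAt.2 fun t ↦ (isMIntegralCurve_lieExp X t).continuousAt

theorem lieExp_add_smul (X : GroupLieAlgebra 𝓘(ℝ, E) G) (s t : ℝ) :
    lieExp (G := G) ((s + t) • X) = lieExp (s • X) * lieExp (t • X) := by
  have h₁ := (isMIntegralCurve_lieExp (G := G) X).comp_add s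
  have h₂ := (isMIntegralCurve_lieExp (G := G) X).mul_left (lieExp (s • X))
  have h := congrFun (isMIntegralCurve_Ioo_eq_of_contMDiff_boundaryless (t₀ := 0)
    (contMDiff_mulInvariantVectorField_one X) h₁ h₂ (by simp [lieExp_zero])) t
  simpa [add_comm s t] using h

theorem map_lieExp {Φ : G →* G} (hΦ : ContMDiff 𝓘(ℝ, E) 𝓘(ℝ, E) ∞ Φ)
    (X : GroupLieAlgebra 𝓘(ℝ, E) G) : Φ (lieExp X) = lieExp (lieDifferential E Φ X) := by
  have h := ((isMIntegralCurve_lieExp X).map_monoidHom hΦ).eq_lieExp (by simp [lieExp_zero]) 1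
  simpa using h

end LieExponential

/-! ### Second-order calculus of a local group -/

section LocalGroupCalculus

open Set Filter Topology

variable {E : Type*} [NormedAddCommGroup E] [NormedSpace ℝ E]

theorem ContDiffAt.fderiv_left_slice {m : E × E → E} {e : E} (hm : ContDiffAt ℝ ∞ m (e, e)) :
    (fun x ↦ fderiv ℝ (fun y ↦ m (x, y)) e) =ᶠ[𝓝 e]
      fun x ↦ (fderiv ℝ m (x, e)).comp (ContinuousLinearMap.inr ℝ E E) := by
  have h : ∀ᶠ z in 𝓝 (e, e), ContDiffAt ℝ 1 m z :=
    (hm.of_le (by exact_mod_cast le_top) : ContDiffAt ℝ 1 m (e, e)).eventually (by simp)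
  have hc : ContinuousAt (fun x : E ↦ (x, e)) e := by fun_prop
  filter_upwards [hc.eventually h] with x hx
  exact ((hx.differentiableAt (by simp)).hasFDerivAt.comp e (hasFDerivAt_prodMk_right x e)).fderiv

theorem ContDiffAt.fderiv_right_slice {m : E × E → E} {e : E} (hm : ContDiffAt ℝ ∞ m (e, e)) :
    (fun x ↦ fderiv ℝ (fun y ↦ m (y, x)) e) =ᶠ[𝓝 e]
      fun x ↦ (fderiv ℝ m (e, x)).comp (ContinuousLinearMap.inl ℝ E E) := by
  have h : ∀ᶠ z in 𝓝 (e, e), ContDiffAt ℝ 1 m z :=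
    (hm.of_le (by exact_mod_cast le_top) : ContDiffAt ℝ 1 m (e, e)).eventually (by simp)
  have hc : ContinuousAt (fun x : E ↦ (e, x)) e := by fun_prop
  filter_upwards [hc.eventually h] with x hx
  exact ((hx.differentiableAt (by simp)).hasFDerivAt.comp e (hasFDerivAt_prodMk_left e x)).fderiv

theorem ContDiffAt.fderiv_two {m : E × E → E} {z : E × E} (hm : ContDiffAt ℝ ∞ m z) :
    ContDiffAt ℝ ∞ (fderiv ℝ m) z :=
  hm.fderiv_right (m := ∞) (by simp)

theorem ContDiffAt.contDiffAt_left_slice {m : E × E → E} {e : E}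
    (hm : ContDiffAt ℝ ∞ m (e, e)) :
    ContDiffAt ℝ ∞ (fun x ↦ fderiv ℝ (fun y ↦ m (x, y)) e) e := by
  refine ContDiffAt.congr_of_eventuallyEq ?_ hm.fderiv_left_slice
  have h : ContDiffAt ℝ ∞ (fun x : E ↦ fderiv ℝ m (x, e)) e :=
    ContDiffAt.comp (g := fderiv ℝ m) (f := fun x : E ↦ (x, e)) e hm.fderiv_two (by fun_prop)
  exact h.clm_comp contDiffAt_const

theorem ContDiffAt.hasFDerivAt_left_slice {m : E × E → E} {e : E}
    (hm : ContDiffAt ℝ ∞ m (e, e)) (X Y : E) :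
    fderiv ℝ (fun x ↦ fderiv ℝ (fun y ↦ m (x, y)) e) e X Y =
      fderiv ℝ (fderiv ℝ m) (e, e) (X, 0) (0, Y) := by
  rw [hm.fderiv_left_slice.fderiv_eq]
  have h := ((hm.fderiv_two.differentiableAt (by simp)).hasFDerivAt).comp
    (f := fun x : E ↦ (x, e)) e (hasFDerivAt_prodMk_left (𝕜 := ℝ) e e)
  have h' := h.clm_comp (hasFDerivAt_const (ContinuousLinearMap.inr ℝ E E) e)
  have := h'.fderiv
  simp only [Function.comp_def] at this
  rw [this]
  simp

/-- Symmetry of the second derivative of `m`: differentiating right translations gives the same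
mixed term as differentiating left translations, with the arguments exchanged. -/
theorem ContDiffAt.hasFDerivAt_right_slice {m : E × E → E} {e : E}
    (hm : ContDiffAt ℝ ∞ m (e, e)) (X : E) :
    HasFDerivAt (fun x ↦ fderiv ℝ (fun y ↦ m (y, x)) e X)
      ((fderiv ℝ (fun x ↦ fderiv ℝ (fun y ↦ m (x, y)) e) e) X) e := by
  have hs : IsSymmSndFDerivAt ℝ m (e, e) := hm.isSymmSndFDerivAt (by
    rw [minSmoothness_of_isRCLikeNormedField]
    exact ENat.LEInfty.out)
  have h := (hm.fderiv_two.differentiableAt (by simp)).hasFDerivAt.comp e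
    (hasFDerivAt_prodMk_right (𝕜 := ℝ) e e)
  have h' := h.clm_apply (hasFDerivAt_const ((X, 0) : E × E) e)
  refine HasFDerivAt.congr_of_eventuallyEq (h'.congr_fderiv ?_) ?_
  · ext Y
    rw [hm.hasFDerivAt_left_slice, hs.eq]
    simp
  · filter_upwards [hm.fderiv_right_slice] with x hx
    rw [hx]
    simp

/-- In a local group with product `m` and conjugation `F`, the derivative of the adjoint action
`x ↦ D(F(x, ·))` at the identity is the commutator of the derivatives of left translations. -/
theorem fderiv_local_adjoint_apply {m F : E × E → E} {e : E} (hm : ContDiffAt ℝ ∞ m (e, e))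
    (hF : ContDiffAt ℝ ∞ F (e, e)) (hmr : ∀ᶠ x in 𝓝 e, m (x, e) = x)
    (hFr : ∀ᶠ x in 𝓝 e, F (x, e) = e) (hFl : ∀ᶠ y in 𝓝 e, F (e, y) = y)
    (hmF : ∀ᶠ z in 𝓝 (e, e), m (F z, z.1) = m z) (X Y : E) :
    fderiv ℝ (fun x ↦ fderiv ℝ (fun y ↦ F (x, y)) e) e X Y =
      fderiv ℝ (fun x ↦ fderiv ℝ (fun y ↦ m (x, y)) e) e X Y -
      fderiv ℝ (fun x ↦ fderiv ℝ (fun y ↦ m (x, y)) e) e Y X := by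
  set A := fun x ↦ fderiv ℝ (fun y ↦ F (x, y)) e with hA
  set L := fun x ↦ fderiv ℝ (fun y ↦ m (x, y)) e with hL
  have hAe : A e = ContinuousLinearMap.id ℝ E := by
    have : (fun y ↦ F (e, y)) =ᶠ[𝓝 e] id := hFl
    rw [hA]; dsimp only; rw [this.fderiv_eq, fderiv_id]
  have hRe : fderiv ℝ (fun y ↦ m (y, e)) e = ContinuousLinearMap.id ℝ E := by
    have : (fun y ↦ m (y, e)) =ᶠ[𝓝 e] id := hmr
    rw [this.fderiv_eq, fderiv_id]
  -- The `y`-derivative at `e` of `(x y x⁻¹) x = x y`: left translation is `A x` followed by the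
  -- derivative `R x` of right translation.
  have hRel : ∀ᶠ x in 𝓝 e, L x Y = (fderiv ℝ m (e, x)).comp (ContinuousLinearMap.inl ℝ E E)
      (A x Y) := by
    have hm1 : ∀ᶠ z in 𝓝 (e, e), ContDiffAt ℝ 1 m z :=
      (hm.of_le (by exact_mod_cast le_top) : ContDiffAt ℝ 1 m (e, e)).eventually (by simp)
    have hF1 : ∀ᶠ z in 𝓝 (e, e), ContDiffAt ℝ 1 F z :=
      (hF.of_le (by exact_mod_cast le_top) : ContDiffAt ℝ 1 F (e, e)).eventually (by simp)
    have hc : ContinuousAt (fun x : E ↦ (e, x)) e := by fun_prop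
    have hc' : ContinuousAt (fun x : E ↦ (x, e)) e := by fun_prop
    filter_upwards [hc.eventually hm1, hc'.eventually hF1, hFr,
      hc'.eventually (eventually_eventually_nhds.2 hmF)] with x hmx hFx hFex hmFx
    have h₁ : (fun y ↦ m (F (x, y), x)) =ᶠ[𝓝 e] fun y ↦ m (x, y) :=
      (show ContinuousAt (fun y : E ↦ (x, y)) e by fun_prop).eventually hmFx
    have h₂ : HasFDerivAt (fun y ↦ F (x, y)) (A x) e :=
      (DifferentiableAt.comp (𝕜 := ℝ) (g := F) (f := fun y : E ↦ (x, y)) e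
        (hFx.differentiableAt (by simp)) (by fun_prop)).hasFDerivAt
    have h₃ : HasFDerivAt (fun w ↦ m (w, x))
        ((fderiv ℝ m (e, x)).comp (ContinuousLinearMap.inl ℝ E E)) (F (x, e)) := by
      rw [hFex]
      exact (hmx.differentiableAt (by simp)).hasFDerivAt.comp e (hasFDerivAt_prodMk_left e x)
    have h₄ := (HasFDerivAt.comp (g := fun w : E ↦ m (w, x)) (f := fun y : E ↦ F (x, y))
      e h₃ h₂).fderiv
    have h₅ := h₁.fderiv_eq (𝕜 := ℝ)
    simp only [Function.comp_def] at h₄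
    rw [hL]; dsimp only
    rw [← h₅, h₄]
    rfl
  have hAd : HasFDerivAt A (fderiv ℝ A e) e :=
    (hF.contDiffAt_left_slice.differentiableAt (by simp)).hasFDerivAt
  have hLd : HasFDerivAt L (fderiv ℝ L e) e :=
    (hm.contDiffAt_left_slice.differentiableAt (by simp)).hasFDerivAt
  have hRd := (hm.fderiv_two.differentiableAt (by simp)).hasFDerivAt.comp e
    (hasFDerivAt_prodMk_right (𝕜 := ℝ) e e)
  have hRd' := (hRd.clm_comp (hasFDerivAt_const (ContinuousLinearMap.inl ℝ E E) e)).clm_apply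
    (hAd.clm_apply (hasFDerivAt_const Y e))
  have hLd' := hLd.clm_apply (hasFDerivAt_const Y e)
  -- The product rule for `L x Y = R x (A x Y)` at `e`, where `A` and `R` are the identity, gives
  -- `L'(X) Y = R'(X) Y + A'(X) Y`; then `hs` identifies `R'(X) Y` with `L'(Y) X`.
  have h := congrArg (fun T : E →L[ℝ] E ↦ T X)
    ((hRd'.congr_of_eventuallyEq hRel).unique hLd')
  have hs := congrArg (fun T : E →L[ℝ] E ↦ T X)
    ((hm.hasFDerivAt_right_slice Y).unique ((hRd.clm_apply
      (hasFDerivAt_const ((Y, 0) : E × E) e)).congr_of_eventuallyEq (by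
        filter_upwards [hm.fderiv_right_slice] with x hx
        rw [hx]; simp)))
  have hRe' := congrArg (fun T : E →L[ℝ] E ↦ T (fderiv ℝ A e X Y)) hRe
  have hfr := hm.fderiv_right_slice.self_of_nhds
  dsimp only at hfr
  rw [hfr] at hRe'
  simp [hAe] at h hs hRe'
  rw [hs, ← h, hRe']
  abel

end LocalGroupCalculus

/-! ### The adjoint representation and its differential -/

section AdjointRepresentation

open Set Filter Topology VectorField

variable {E : Type*} [NormedAddCommGroup E] [NormedSpace ℝ E]
  {G : Type*} [TopologicalSpace G] [ChartedSpace E G] [Group G] [LieGroup 𝓘(ℝ, E) ∞ G]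

theorem mdifferentiableAt_conj_lieGroup (g h : G) :
    MDifferentiableAt 𝓘(ℝ, E) 𝓘(ℝ, E) (fun x ↦ g * x * g⁻¹) h :=
  ((contMDiff_mul_right (I := 𝓘(ℝ, E)) (n := ∞) (a := g⁻¹)).comp
    (contMDiff_mul_left (I := 𝓘(ℝ, E)) (n := ∞) (a := g))).mdifferentiableAt (by simp)

/-- The adjoint representation of a Lie group on its Lie algebra. -/
noncomputable def adjointRep (E : Type*) [NormedAddCommGroup E] [NormedSpace ℝ E]
    (G : Type*) [TopologicalSpace G] [ChartedSpace E G] [Group G] [LieGroup 𝓘(ℝ, E) ∞ G] :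
    G →* (E →L[ℝ] E) where
  toFun g := mfderivModel E (fun x ↦ g * x * g⁻¹) 1
  map_one' := by
    have : (fun x : G ↦ 1 * x * 1⁻¹) = id := by ext; simp
    rw [this]
    exact mfderiv_id
  map_mul' g h := by
    have key : (fun x : G ↦ g * h * x * (g * h)⁻¹) =
        (fun x ↦ g * x * g⁻¹) ∘ (fun x ↦ h * x * h⁻¹) := by
      ext; simp [mul_assoc]
    rw [key, mfderivModel_comp (mdifferentiableAt_conj_lieGroup g _)
      (mdifferentiableAt_conj_lieGroup h _), mul_one, mul_inv_cancel]
    rfl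

/-- The product of the group in the preferred chart at the identity. -/
noncomputable def chartMul (E : Type*) [NormedAddCommGroup E] [NormedSpace ℝ E]
    (G : Type*) [TopologicalSpace G] [ChartedSpace E G] [Group G] (z : E × E) : E :=
  extChartAt 𝓘(ℝ, E) (1 : G)
    ((extChartAt 𝓘(ℝ, E) (1 : G)).symm z.1 * (extChartAt 𝓘(ℝ, E) (1 : G)).symm z.2)

/-- Conjugation in the preferred chart at the identity. -/
noncomputable def chartConj (E : Type*) [NormedAddCommGroup E] [NormedSpace ℝ E]
    (G : Type*) [TopologicalSpace G] [ChartedSpace E G] [Group G] (z : E × E) : E :=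
  extChartAt 𝓘(ℝ, E) (1 : G)
    ((extChartAt 𝓘(ℝ, E) (1 : G)).symm z.1 * (extChartAt 𝓘(ℝ, E) (1 : G)).symm z.2 *
      ((extChartAt 𝓘(ℝ, E) (1 : G)).symm z.1)⁻¹)

theorem contMDiffAt_extChartAt_symm_one :
    ContMDiffAt 𝓘(ℝ, E) 𝓘(ℝ, E) ∞ (extChartAt 𝓘(ℝ, E) (1 : G)).symm
      (extChartAt 𝓘(ℝ, E) (1 : G) 1) :=
  (contMDiffOn_extChartAt_symm (1 : G)).contMDiffAt (extChartAt_target_mem_nhds (1 : G))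

theorem contMDiffAt_chart_symm_fst :
    ContMDiffAt 𝓘(ℝ, E × E) 𝓘(ℝ, E) ∞
      (fun z : E × E ↦ (extChartAt 𝓘(ℝ, E) (1 : G)).symm z.1)
      (extChartAt 𝓘(ℝ, E) (1 : G) 1, extChartAt 𝓘(ℝ, E) (1 : G) 1) :=
  ContMDiffAt.comp (g := (extChartAt 𝓘(ℝ, E) (1 : G)).symm) (f := Prod.fst)
    (extChartAt 𝓘(ℝ, E) (1 : G) 1, extChartAt 𝓘(ℝ, E) (1 : G) 1)
    contMDiffAt_extChartAt_symm_one contDiff_fst.contMDiff.contMDiffAt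

theorem contMDiffAt_chart_symm_snd :
    ContMDiffAt 𝓘(ℝ, E × E) 𝓘(ℝ, E) ∞
      (fun z : E × E ↦ (extChartAt 𝓘(ℝ, E) (1 : G)).symm z.2)
      (extChartAt 𝓘(ℝ, E) (1 : G) 1, extChartAt 𝓘(ℝ, E) (1 : G) 1) :=
  ContMDiffAt.comp (g := (extChartAt 𝓘(ℝ, E) (1 : G)).symm) (f := Prod.snd)
    (extChartAt 𝓘(ℝ, E) (1 : G) 1, extChartAt 𝓘(ℝ, E) (1 : G) 1)
    contMDiffAt_extChartAt_symm_one contDiff_snd.contMDiff.contMDiffAt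

theorem contDiffAt_chartMul : ContDiffAt ℝ ∞ (chartMul E G)
    (extChartAt 𝓘(ℝ, E) (1 : G) 1, extChartAt 𝓘(ℝ, E) (1 : G) 1) := by
  rw [← contMDiffAt_iff_contDiffAt]
  have h := (contMDiffAt_chart_symm_fst (E := E) (G := G)).mul
    (contMDiffAt_chart_symm_snd (E := E) (G := G))
  refine ContMDiffAt.comp (g := extChartAt 𝓘(ℝ, E) (1 : G)) (I' := 𝓘(ℝ, E)) _ ?_ h
  apply contMDiffAt_extChartAt'
  simp

theorem contDiffAt_chartConj : ContDiffAt ℝ ∞ (chartConj E G)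
    (extChartAt 𝓘(ℝ, E) (1 : G) 1, extChartAt 𝓘(ℝ, E) (1 : G) 1) := by
  rw [← contMDiffAt_iff_contDiffAt]
  have h := ((contMDiffAt_chart_symm_fst (E := E) (G := G)).mul
    (contMDiffAt_chart_symm_snd (E := E) (G := G))).mul
    (contMDiffAt_chart_symm_fst (E := E) (G := G)).inv
  refine ContMDiffAt.comp (g := extChartAt 𝓘(ℝ, E) (1 : G)) (I' := 𝓘(ℝ, E)) _ ?_ h
  apply contMDiffAt_extChartAt'
  simp

omit [LieGroup 𝓘(ℝ, E) ∞ G] in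
theorem eventually_mem_extChartAt_target_one :
    ∀ᶠ x in 𝓝 (extChartAt 𝓘(ℝ, E) (1 : G) 1), x ∈ (extChartAt 𝓘(ℝ, E) (1 : G)).target :=
  extChartAt_target_mem_nhds (1 : G)

omit [LieGroup 𝓘(ℝ, E) ∞ G] in
theorem mfderivModel_one_eq_fderiv {f : G → G} (h1 : f 1 = 1)
    (hf : MDifferentiableAt 𝓘(ℝ, E) 𝓘(ℝ, E) f 1) :
    mfderivModel E f 1 = fderiv ℝ (fun y ↦ extChartAt 𝓘(ℝ, E) (1 : G)
      (f ((extChartAt 𝓘(ℝ, E) (1 : G)).symm y))) (extChartAt 𝓘(ℝ, E) (1 : G) 1) := by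
  have h : mfderivModel E f 1 = fderiv ℝ (fun y ↦ extChartAt 𝓘(ℝ, E) (f 1)
      (f ((extChartAt 𝓘(ℝ, E) (1 : G)).symm y))) (extChartAt 𝓘(ℝ, E) (1 : G) 1) := by
    have h₀ : mfderivModel E f 1 = fderivWithin ℝ (writtenInExtChartAt 𝓘(ℝ, E) 𝓘(ℝ, E) 1 f)
        (range 𝓘(ℝ, E)) (extChartAt 𝓘(ℝ, E) (1 : G) 1) := hf.mfderiv
    rw [h₀, modelWithCornersSelf_coe, range_id, fderivWithin_univ]
    rfl
  rw [h, h1]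

omit [Group G] [LieGroup 𝓘(ℝ, E) ∞ G] in
theorem mfderiv_eq_fderiv_comp_extChartAt_symm {f : G → E} {a : G}
    (hf : MDifferentiableAt 𝓘(ℝ, E) 𝓘(ℝ, E) f a) (v : E) :
    (mfderiv 𝓘(ℝ, E) 𝓘(ℝ, E) f a v : E) = fderiv ℝ
      (fun y ↦ f ((extChartAt 𝓘(ℝ, E) a).symm y)) (extChartAt 𝓘(ℝ, E) a a) v := by
  have h : (mfderiv 𝓘(ℝ, E) 𝓘(ℝ, E) f a : E →L[ℝ] E) =
      fderivWithin ℝ (writtenInExtChartAt 𝓘(ℝ, E) 𝓘(ℝ, E) a f)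
        (range 𝓘(ℝ, E)) (extChartAt 𝓘(ℝ, E) a a) := hf.mfderiv
  rw [modelWithCornersSelf_coe, range_id, fderivWithin_univ] at h
  exact congrArg (fun F : E →L[ℝ] E ↦ F v) h

theorem adjointRep_chart_symm (x : E) :
    adjointRep E G ((extChartAt 𝓘(ℝ, E) (1 : G)).symm x) =
      fderiv ℝ (fun y ↦ chartConj E G (x, y)) (extChartAt 𝓘(ℝ, E) (1 : G) 1) :=
  mfderivModel_one_eq_fderiv (by simp) (mdifferentiableAt_conj_lieGroup _ _)

theorem mpullbackWithin_mulInvariantVectorField (X : GroupLieAlgebra 𝓘(ℝ, E) G) {x : E}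
    (hx : x ∈ (extChartAt 𝓘(ℝ, E) (1 : G)).target) :
    (mpullbackWithin 𝓘(ℝ, E) 𝓘(ℝ, E) (extChartAt 𝓘(ℝ, E) (1 : G)).symm
      (mulInvariantVectorField X) (range 𝓘(ℝ, E)) x : E) =
    fderiv ℝ (fun y ↦ chartMul E G (x, y)) (extChartAt 𝓘(ℝ, E) (1 : G) 1) X := by
  set g := (extChartAt 𝓘(ℝ, E) (1 : G)).symm x with hg
  have hgs : g ∈ (chartAt E (1 : G)).source := by
    rw [← extChartAt_source 𝓘(ℝ, E)]
    exact (extChartAt 𝓘(ℝ, E) (1 : G)).map_target hx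
  have hinv := ContinuousLinearMap.inverse_eq
    (mfderivWithin_extChartAt_symm_comp_mfderiv_extChartAt hx)
    (mfderiv_extChartAt_comp_mfderivWithin_extChartAt_symm hx)
  rw [mpullbackWithin_apply, hinv]
  have hφ : MDifferentiableAt 𝓘(ℝ, E) 𝓘(ℝ, E) (extChartAt 𝓘(ℝ, E) (1 : G)) (g * 1) := by
    rw [mul_one]
    exact mdifferentiableAt_extChartAt hgs
  have hc := mfderiv_comp (1 : G) hφ (mdifferentiableAt_mul_left_lieGroup g 1)
  have h := mfderiv_eq_fderiv_comp_extChartAt_symm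
    (hφ.comp (1 : G) (mdifferentiableAt_mul_left_lieGroup g 1)) X
  have hc' : (mfderiv 𝓘(ℝ, E) 𝓘(ℝ, E) (extChartAt 𝓘(ℝ, E) (1 : G) ∘ (g * ·)) 1 : E →L[ℝ] E) =
    (mfderiv 𝓘(ℝ, E) 𝓘(ℝ, E) (extChartAt 𝓘(ℝ, E) (1 : G)) (g * 1) : E →L[ℝ] E).comp
      (mfderivModel E (g * ·) 1) := hc
  rw [mul_one] at hc'
  exact (congrArg (fun F : E →L[ℝ] E ↦ F X) hc').symm.trans h

theorem hasStrictFDerivAt_adjointRep_chart_symm :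
    HasStrictFDerivAt (fun x ↦ adjointRep E G ((extChartAt 𝓘(ℝ, E) (1 : G)).symm x))
      (fderiv ℝ (fun x ↦ adjointRep E G ((extChartAt 𝓘(ℝ, E) (1 : G)).symm x))
        (extChartAt 𝓘(ℝ, E) (1 : G) 1)) (extChartAt 𝓘(ℝ, E) (1 : G) 1) := by
  simp_rw [adjointRep_chart_symm]
  exact (contDiffAt_chartConj (G := G)).contDiffAt_left_slice.hasStrictFDerivAt (by simp)

/-- In the chart the left-invariant field of `X` is `x ↦ L x X`, with `L e` the identity, so the
vector field bracket at `e` involves only the first derivative of `L`. -/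
theorem bracket_eq_chartMul (X Y : GroupLieAlgebra 𝓘(ℝ, E) G) :
    (⁅X, Y⁆ : GroupLieAlgebra 𝓘(ℝ, E) G) =
      fderiv ℝ (fun x ↦ fderiv ℝ (fun y ↦ chartMul E G (x, y)) (extChartAt 𝓘(ℝ, E) (1 : G) 1))
        (extChartAt 𝓘(ℝ, E) (1 : G) 1) X Y -
      fderiv ℝ (fun x ↦ fderiv ℝ (fun y ↦ chartMul E G (x, y)) (extChartAt 𝓘(ℝ, E) (1 : G) 1))
        (extChartAt 𝓘(ℝ, E) (1 : G) 1) Y X := by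
  set e := extChartAt 𝓘(ℝ, E) (1 : G) 1 with he
  set L := fun x ↦ fderiv ℝ (fun y ↦ chartMul E G (x, y)) e with hL
  have hLd : DifferentiableAt ℝ L e :=
    (contDiffAt_chartMul (E := E) (G := G)).contDiffAt_left_slice.differentiableAt (by simp)
  let V (X : E) (x : E) : E :=
    mpullbackWithin 𝓘(ℝ, E) 𝓘(ℝ, E) (extChartAt 𝓘(ℝ, E) (1 : G)).symm
      (mulInvariantVectorField (X : GroupLieAlgebra 𝓘(ℝ, E) G)) (range 𝓘(ℝ, E)) x
  have hV (X : E) : V X =ᶠ[𝓝 e] fun x ↦ L x X := by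
    filter_upwards [eventually_mem_extChartAt_target_one (G := G)] with x hx
    exact mpullbackWithin_mulInvariantVectorField X hx
  have hVd (X : E) : fderiv ℝ (V X) e = (fderiv ℝ L e).flip X := by
    rw [(hV X).fderiv_eq]
    have := (hLd.hasFDerivAt.clm_apply (hasFDerivAt_const (X : E) e)).fderiv
    rw [this]
    ext
    simp only [add_apply, ContinuousLinearMap.comp_apply,
      zero_apply, map_zero, zero_add]
  have hLe : L e = ContinuousLinearMap.id ℝ E := by
    have : (fun y ↦ chartMul E G (e, y)) =ᶠ[𝓝 e] id := by
      filter_upwards [eventually_mem_extChartAt_target_one (G := G)] with x hx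
      simpa [chartMul, he] using (extChartAt 𝓘(ℝ, E) (1 : G)).right_inv hx
    rw [hL]; dsimp only
    rw [this.fderiv_eq, fderiv_id]
  have hVe (X : E) : V X e = X := by
    have h := (hV X).self_of_nhds
    dsimp only at h
    rw [h, hLe]; rfl
  -- The bracket on the manifold is the chart bracket transported by the derivative of the chart at
  -- its base point, which is the identity.
  have h₁ : (⁅X, Y⁆ : GroupLieAlgebra 𝓘(ℝ, E) G) =
      (lieBracketWithin ℝ (V X) (V Y) ((extChartAt 𝓘(ℝ, E) (1 : G)).symm ⁻¹' univ ∩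
        range 𝓘(ℝ, E)) e : E) := by
    have key (F : E →L[ℝ] E) (hF : F = ContinuousLinearMap.id ℝ E) (v : E) : F.inverse v = v := by
      rw [hF, ContinuousLinearMap.inverse_id]
      rfl
    exact key _ mfderiv_extChartAt_self _
  have h₂ (X Y : E) : lieBracketWithin ℝ (V X) (V Y)
      ((extChartAt 𝓘(ℝ, E) (1 : G)).symm ⁻¹' univ ∩ range 𝓘(ℝ, E)) e =
      fderiv ℝ L e X Y - fderiv ℝ L e Y X := by
    rw [preimage_univ, modelWithCornersSelf_coe, range_id, inter_self, lieBracketWithin_univ,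
      lieBracket_eq]
    dsimp only
    rw [hVd, hVd, hVe, hVe]
    rfl
  exact h₁.trans (h₂ X Y)

theorem fderiv_adjointRep_chart_symm_apply [CompleteSpace E] (X Y : GroupLieAlgebra 𝓘(ℝ, E) G) :
    fderiv ℝ (fun x ↦ adjointRep E G ((extChartAt 𝓘(ℝ, E) (1 : G)).symm x))
      (extChartAt 𝓘(ℝ, E) (1 : G) 1) X Y = (⁅X, Y⁆ : GroupLieAlgebra 𝓘(ℝ, E) G) := by
  simp_rw [adjointRep_chart_symm]
  rw [bracket_eq_chartMul]
  refine fderiv_local_adjoint_apply (contDiffAt_chartMul (E := E) (G := G))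
    (contDiffAt_chartConj (E := E) (G := G)) ?_ ?_ ?_ ?_ X Y
  · filter_upwards [eventually_mem_extChartAt_target_one (G := G)] with x hx
    simpa [chartMul] using (extChartAt 𝓘(ℝ, E) (1 : G)).right_inv hx
  · filter_upwards with x
    simp [chartConj]
  · filter_upwards [eventually_mem_extChartAt_target_one (G := G)] with x hx
    simpa [chartConj] using (extChartAt 𝓘(ℝ, E) (1 : G)).right_inv hx
  · have hc : ContinuousAt (fun z : E × E ↦ (extChartAt 𝓘(ℝ, E) (1 : G)).symm z.1 *
        (extChartAt 𝓘(ℝ, E) (1 : G)).symm z.2 * ((extChartAt 𝓘(ℝ, E) (1 : G)).symm z.1)⁻¹)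
        (extChartAt 𝓘(ℝ, E) (1 : G) 1, extChartAt 𝓘(ℝ, E) (1 : G) 1) :=
      (((contMDiffAt_chart_symm_fst (E := E) (G := G)).mul
    (contMDiffAt_chart_symm_snd (E := E) (G := G))).mul
        (contMDiffAt_chart_symm_fst (E := E) (G := G)).inv).continuousAt
    have hs : (extChartAt 𝓘(ℝ, E) (1 : G)).source ∈ 𝓝 ((extChartAt 𝓘(ℝ, E) (1 : G)).symm
        (extChartAt 𝓘(ℝ, E) (1 : G) 1) * (extChartAt 𝓘(ℝ, E) (1 : G)).symm
        (extChartAt 𝓘(ℝ, E) (1 : G) 1) * ((extChartAt 𝓘(ℝ, E) (1 : G)).symm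
        (extChartAt 𝓘(ℝ, E) (1 : G) 1))⁻¹) := by
      simpa using extChartAt_source_mem_nhds (I := 𝓘(ℝ, E)) (1 : G)
    filter_upwards [hc.eventually hs] with z hz
    simp only [chartMul, chartConj]
    rw [(extChartAt 𝓘(ℝ, E) (1 : G)).left_inv hz]
    simp

end AdjointRepresentation

/-! ### Local injectivity of `Ad`, and `Ad (exp X) = e^{ad X}` -/

section AdjointExponential

open Set Filter Topology

variable {E : Type*} [NormedAddCommGroup E] [NormedSpace ℝ E]
  {G : Type*} [TopologicalSpace G] [ChartedSpace E G] [Group G] [LieGroup 𝓘(ℝ, E) ∞ G]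

theorem ContinuousLinearMap.exp_apply_of_apply_eq_smul [CompleteSpace E] {A : E →L[ℝ] E} {v : E}
    {μ : ℝ} (h : A v = μ • v) : NormedSpace.exp A v = Real.exp μ • v := by
  have hpow (n : ℕ) : (A ^ n) v = μ ^ n • v := by
    induction n with
    | zero => simp
    | succ n ih =>
      rw [pow_succ]
      change (A ^ n) (A v) = _
      rw [h, map_smul, ih, smul_smul, pow_succ']
  have h₁ := (NormedSpace.exp_series_hasSum_exp' (𝕂 := ℝ) A).mapL
    (ContinuousLinearMap.apply ℝ E v)
  have h₂ := (NormedSpace.exp_series_hasSum_exp' (𝕂 := ℝ) μ).smul_const v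
  rw [← Real.exp_eq_exp_ℝ] at h₂
  have h₃ : (fun n : ℕ ↦ ContinuousLinearMap.apply ℝ E v ((n.factorial⁻¹ : ℝ) • A ^ n)) =
      fun n ↦ ((n.factorial⁻¹ : ℝ) • μ ^ n) • v := by
    funext n
    change (n.factorial⁻¹ : ℝ) • (A ^ n) v = _
    rw [hpow, smul_assoc]
  rw [h₃] at h₁
  exact h₁.unique h₂

theorem continuous_adjointRep : Continuous (adjointRep E G) := by
  have : IsTopologicalGroup G := topologicalGroup_of_lieGroup 𝓘(ℝ, E) ∞
  have h₁ : ContinuousAt (adjointRep E G) 1 := by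
    have h := ContinuousAt.comp
      (f := extChartAt 𝓘(ℝ, E) (1 : G)) (x := (1 : G))
      (hasStrictFDerivAt_adjointRep_chart_symm (E := E) (G := G)).hasFDerivAt.continuousAt
      (continuousAt_extChartAt (1 : G))
    refine h.congr ?_
    filter_upwards [extChartAt_source_mem_nhds (I := 𝓘(ℝ, E)) (1 : G)] with g hg
    simp only [Function.comp_apply]
    rw [(extChartAt 𝓘(ℝ, E) (1 : G)).left_inv hg]
  exact continuous_of_continuousAt_one (adjointRep E G) h₁

/-- The differential `ad` of `Ad` is injective when the center is trivial. Composing with a linear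
left inverse of `ad` gives a map with derivative the identity, to which the inverse function theorem
applies. -/
theorem exists_injOn_adjointRep [CompleteSpace E] [FiniteDimensional ℝ E]
    (hc : ∀ X : GroupLieAlgebra 𝓘(ℝ, E) G,
      (∀ Y : GroupLieAlgebra 𝓘(ℝ, E) G, ⁅X, Y⁆ = 0) → X = 0) :
    ∃ U ∈ 𝓝 (1 : G), InjOn (adjointRep E G) U := by
  set A := fderiv ℝ (fun x ↦ adjointRep E G ((extChartAt 𝓘(ℝ, E) (1 : G)).symm x))
      (extChartAt 𝓘(ℝ, E) (1 : G) 1) with hA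
  have hker : LinearMap.ker (A : E →ₗ[ℝ] E →L[ℝ] E) = ⊥ := by
    refine (Submodule.eq_bot_iff _).2 fun X hX ↦ hc X fun Y ↦ ?_
    rw [← fderiv_adjointRep_chart_symm_apply X Y]
    exact congrArg (fun F : E →L[ℝ] E ↦ F Y) (LinearMap.mem_ker.1 hX)
  obtain ⟨P, hP⟩ := (A : E →ₗ[ℝ] E →L[ℝ] E).exists_leftInverse_of_injective hker
  have h := (LinearMap.toContinuousLinearMap P).hasStrictFDerivAt.comp _
    (hasStrictFDerivAt_adjointRep_chart_symm (E := E) (G := G))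
  have h' := h.congr_fderiv (g' := (ContinuousLinearEquiv.refl ℝ E : E →L[ℝ] E)) (by
    ext X
    exact congrArg (fun F : E →ₗ[ℝ] E ↦ F X) hP)
  set e := h'.toOpenPartialHomeomorph _
  have he : e.source ∈ 𝓝 (extChartAt 𝓘(ℝ, E) (1 : G) 1) :=
    e.open_source.mem_nhds h'.mem_toOpenPartialHomeomorph_source
  refine ⟨_, inter_mem (extChartAt_source_mem_nhds (I := 𝓘(ℝ, E)) (1 : G))
    ((continuousAt_extChartAt (I := 𝓘(ℝ, E)) (1 : G)).preimage_mem_nhds he), ?_⟩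
  rintro g ⟨hg, hge⟩ g' ⟨hg', hge'⟩ hgg
  refine (extChartAt 𝓘(ℝ, E) (1 : G)).injOn hg hg' (e.injOn hge hge' ?_)
  change P (adjointRep E G ((extChartAt 𝓘(ℝ, E) (1 : G)).symm _)) =
    P (adjointRep E G ((extChartAt 𝓘(ℝ, E) (1 : G)).symm _))
  rw [(extChartAt 𝓘(ℝ, E) (1 : G)).left_inv hg, (extChartAt 𝓘(ℝ, E) (1 : G)).left_inv hg', hgg]

variable [CompleteSpace E] [T2Space G]

theorem hasDerivAt_adjointRep_lieExp_zero (X : GroupLieAlgebra 𝓘(ℝ, E) G) :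
    HasDerivAt (fun t : ℝ ↦ adjointRep E G (lieExp (t • X)))
      (fderiv ℝ (fun x ↦ adjointRep E G ((extChartAt 𝓘(ℝ, E) (1 : G)).symm x))
        (extChartAt 𝓘(ℝ, E) (1 : G) 1) X) 0 := by
  set γ := fun t : ℝ ↦ lieExp (G := G) (t • X) with hγ
  have h0 : γ 0 = 1 := by simp [hγ, lieExp_zero]
  have hd : HasDerivAt (fun t ↦ extChartAt 𝓘(ℝ, E) (1 : G) (γ t)) (X : E) 0 := by
    have h := (isMIntegralCurve_lieExp X 0).2.hasFDerivAt (by simp)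
    have hv : ∀ g : G, g = 1 → (mulInvariantVectorField X g : E) = X := by
      rintro _ rfl
      have : (fun x : G ↦ 1 * x) = id := by ext; simp
      change mfderivModel E (fun x : G ↦ 1 * x) 1 X = X
      rw [this]
      exact congrArg (fun F : E →L[ℝ] E ↦ F X) mfderiv_id
    have h₂ : HasFDerivAt (fun t ↦ extChartAt 𝓘(ℝ, E) (γ 0) (γ t))
      ((1 : ℝ →L[ℝ] ℝ).smulRight (mulInvariantVectorField X (γ 0) : E)) 0 := h
    rw [h0, hv _ rfl] at h₂
    have h₃ := h₂.hasDerivAt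
    exact h₃.congr_deriv (one_smul ℝ (X : E))
  have hA := (hasStrictFDerivAt_adjointRep_chart_symm (E := E) (G := G)).hasFDerivAt
  have hγc : ContinuousAt γ 0 := (continuous_lieExp_smul X).continuousAt
  have h := HasFDerivAt.comp_hasDerivAt (f := fun t ↦ extChartAt 𝓘(ℝ, E) (1 : G) (γ t)) (0 : ℝ)
    (by rw [h0]; exact hA) hd
  refine h.congr_of_eventuallyEq ?_
  have hs : (extChartAt 𝓘(ℝ, E) (1 : G)).source ∈ 𝓝 (γ 0) := by
    rw [h0]; exact extChartAt_source_mem_nhds (1 : G)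
  filter_upwards [hγc.eventually hs] with t ht
  simp only [Function.comp_apply]
  rw [(extChartAt 𝓘(ℝ, E) (1 : G)).left_inv ht]

/-- The one-parameter group `f t = Ad (exp (t X))` satisfies `f' = f A`, so `f t * e^{-tA}` is
constant. -/
theorem adjointRep_lieExp (X : GroupLieAlgebra 𝓘(ℝ, E) G) :
    adjointRep E G (lieExp X) = NormedSpace.exp
      (fderiv ℝ (fun x ↦ adjointRep E G ((extChartAt 𝓘(ℝ, E) (1 : G)).symm x))
        (extChartAt 𝓘(ℝ, E) (1 : G) 1) X) := by
  set A := fderiv ℝ (fun x ↦ adjointRep E G ((extChartAt 𝓘(ℝ, E) (1 : G)).symm x))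
        (extChartAt 𝓘(ℝ, E) (1 : G) 1) X with hA
  set f := fun t : ℝ ↦ adjointRep E G (lieExp (t • X)) with hf
  have hfd (t : ℝ) : HasDerivAt f (f t * A) t := by
    have h : HasDerivAt (fun s ↦ f (s + -t)) A t :=
      HasDerivAt.comp_add_const t (-t) (by
        rw [add_neg_cancel]
        exact hasDerivAt_adjointRep_lieExp_zero X)
    have h' := h.const_mul (f t)
    refine h'.congr_of_eventuallyEq (Eventually.of_forall fun s ↦ ?_)
    simp only [hf]
    rw [← map_mul, ← lieExp_add_smul]
    simp
  have hed (t : ℝ) : HasDerivAt (fun u : ℝ ↦ NormedSpace.exp (u • -A))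
      (-A * NormedSpace.exp (t • -A)) t :=
    hasDerivAt_exp_smul_const' (𝕂 := ℝ) (-A) t
  have hmul (t : ℝ) : HasDerivAt (fun u ↦ f u * NormedSpace.exp (u • -A)) 0 t := by
    refine ((hfd t).mul (hed t)).congr_deriv ?_
    noncomm_ring
  have hconst := is_const_of_deriv_eq_zero (fun t ↦ (hmul t).differentiableAt)
    (fun t ↦ (hmul t).deriv) 1 0
  simp only [hf, one_smul, zero_smul, lieExp_zero, map_one, NormedSpace.exp_zero, mul_one]
    at hconst
  have hinv : NormedSpace.exp (-A) * NormedSpace.exp A = 1 := by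
    let _ : NormedAlgebra ℚ (E →L[ℝ] E) := NormedAlgebra.restrictScalars ℚ ℝ _
    rw [← NormedSpace.exp_add_of_commute (Commute.neg_left (Commute.refl A))]
    simp
  calc adjointRep E G (lieExp X)
      = adjointRep E G (lieExp X) * (NormedSpace.exp (-A) * NormedSpace.exp A) := by
        rw [hinv, mul_one]
    _ = NormedSpace.exp A := by rw [← mul_assoc, hconst, one_mul]

theorem continuous_adjointRep_lieExp :
    Continuous fun X : GroupLieAlgebra 𝓘(ℝ, E) G ↦ adjointRep E G (lieExp X) := by
  simp_rw [adjointRep_lieExp]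
  let _ : NormedAlgebra ℚ (E →L[ℝ] E) := NormedAlgebra.restrictScalars ℚ ℝ _
  have h : Continuous fun X : E ↦ NormedSpace.exp
      (fderiv ℝ (fun x ↦ adjointRep E G ((extChartAt 𝓘(ℝ, E) (1 : G)).symm x))
        (extChartAt 𝓘(ℝ, E) (1 : G) 1) X) :=
    NormedSpace.exp_continuous.comp (ContinuousLinearMap.continuous _)
  exact h

theorem adjointRep_lieExp_apply_of_lie_eq_smul {X v : GroupLieAlgebra 𝓘(ℝ, E) G} {μ : ℝ}
    (h : ⁅X, v⁆ = μ • v) : adjointRep E G (lieExp X) v = (Real.exp μ • v : E) := by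
  rw [adjointRep_lieExp]
  refine ContinuousLinearMap.exp_apply_of_apply_eq_smul ?_
  exact (fderiv_adjointRep_chart_symm_apply X v).trans h

end AdjointExponential

/-! ### Operators diagonal in a basis -/

section SymmetricOperators

open Module

variable {V : Type*} [AddCommGroup V] [Module ℝ V]

theorem exists_orthonormal_eigenbasis [FiniteDimensional ℝ V] (B : LinearMap.BilinForm ℝ V)
    (hs : ∀ x y, B x y = B y x) (hp : ∀ x, x ≠ 0 → 0 < B x x) (T : V →ₗ[ℝ] V)
    (hT : ∀ x y, B (T x) y = B x (T y)) :
    ∃ (b : Basis (Fin (finrank ℝ V)) ℝ V) (μ : Fin (finrank ℝ V) → ℝ),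
      (∀ i j, B (b i) (b j) = if i = j then 1 else 0) ∧ ∀ i, T (b i) = μ i • b i := by
  let core : InnerProductSpace.Core ℝ V :=
    { inner := fun x y ↦ B x y
      conj_inner_symm := fun x y ↦ by simpa using hs y x
      re_inner_nonneg := fun x ↦ by
        rcases eq_or_ne x 0 with rfl | hx
        · simp
        · simpa using (hp x hx).le
      add_left := fun x y z ↦ by simp
      smul_left := fun x y r ↦ by simp
      definite := fun x hx ↦ by
        by_contra h
        exact (hp x h).ne' hx }
  let _ : NormedAddCommGroup V := core.toNormedAddCommGroup
  let _ : InnerProductSpace ℝ V := InnerProductSpace.ofCore core.toCore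
  have hsym : T.IsSymmetric := hT
  refine ⟨(hsym.eigenvectorBasis rfl).toBasis, hsym.eigenvalues rfl, fun i j ↦ ?_, fun i ↦ ?_⟩
  · have h := orthonormal_iff_ite.1 (hsym.eigenvectorBasis rfl).orthonormal i j
    simpa using! h
  · simpa using hsym.apply_eigenvectorBasis rfl i

theorem Module.Basis.repr_apply_of_eigenbasis {ι : Type*} (b : Basis ι ℝ V) {T : V →ₗ[ℝ] V}
    {μ : ι → ℝ} (hT : ∀ i, T (b i) = μ i • b i) (v : V) (i : ι) :
    b.repr (T v) i = μ i * b.repr v i := by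
  have h : Finsupp.lapply i ∘ₗ b.repr.toLinearMap ∘ₗ T =
      μ i • (Finsupp.lapply i ∘ₗ b.repr.toLinearMap) := by
    refine b.ext fun j ↦ ?_
    simp only [LinearMap.comp_apply, hT, map_smul, LinearMap.smul_apply, LinearEquiv.coe_coe,
      Basis.repr_self, Finsupp.lapply_apply]
    rcases eq_or_ne j i with rfl | hji
    · rfl
    · simp [Finsupp.single_eq_of_ne hji.symm]
  exact congrArg (fun F : V →ₗ[ℝ] ℝ ↦ F v) h

theorem trace_of_eigenbasis {ι : Type*} [Fintype ι] (b : Basis ι ℝ V) {T : V →ₗ[ℝ] V}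
    {μ : ι → ℝ} (hT : ∀ i, T (b i) = μ i • b i) : LinearMap.trace ℝ V T = ∑ i, μ i := by
  classical
  rw [LinearMap.trace_eq_matrix_trace ℝ b, Matrix.trace]
  refine Finset.sum_congr rfl fun i _ ↦ ?_
  simp [LinearMap.toMatrix_apply, hT]

theorem symmetric_of_eigenbasis {ι : Type*} [DecidableEq ι] (B : LinearMap.BilinForm ℝ V)
    (b : Basis ι ℝ V) (hb : ∀ i j, B (b i) (b j) = if i = j then 1 else 0) {T : V →ₗ[ℝ] V}
    {μ : ι → ℝ} (hT : ∀ i, T (b i) = μ i • b i) (x y : V) : B (T x) y = B x (T y) := by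
  have h : B.compLeft T = B.compRight T := by
    refine LinearMap.BilinForm.ext_basis b fun i j ↦ ?_
    simp only [LinearMap.BilinForm.compLeft_apply, LinearMap.BilinForm.compRight_apply, hT,
      map_smul, LinearMap.smul_apply, hb]
    rcases eq_or_ne i j with rfl | hij
    · rfl
    · simp [hij]
  exact congrArg (fun F : LinearMap.BilinForm ℝ V ↦ F x y) h

/-- If two operators are diagonal in a common basis and the eigenvalue `α` of the first forces the
eigenvalue `β` of the second, then `α`-eigenvectors of the first are `β`-eigenvectors of the
second. -/
theorem apply_eq_smul_of_eigenbasis {ι : Type*} (b : Basis ι ℝ V) {S T : V →ₗ[ℝ] V}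
    {μ ν : ι → ℝ} (hS : ∀ i, S (b i) = μ i • b i) (hT : ∀ i, T (b i) = ν i • b i)
    {v : V} {α β : ℝ} (hv : S v = α • v) (hαβ : ∀ i, μ i = α → ν i = β) : T v = β • v := by
  refine b.repr.injective (Finsupp.ext fun i ↦ ?_)
  have h := b.repr_apply_of_eigenbasis hS v i
  rw [hv, map_smul, Finsupp.smul_apply, smul_eq_mul] at h
  rw [b.repr_apply_of_eigenbasis hT, map_smul, Finsupp.smul_apply, smul_eq_mul]
  by_cases h0 : b.repr v i = 0
  · simp [h0]
  · rw [hαβ i (mul_right_cancel₀ h0 h).symm]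

end SymmetricOperators

/-! ### Cartan involutions and positive automorphisms -/

section CartanInvolution

open Module

variable {L : Type*} [LieRing L] [LieAlgebra ℝ L] {θ : L →ₗ[ℝ] L}

/-- The form `B_θ(X, Y) = -B(X, θ Y)`, where `B` is the Killing form. -/
noncomputable def cartanForm (θ : L →ₗ[ℝ] L) : LinearMap.BilinForm ℝ L :=
  -(killingForm ℝ L).compRight θ

theorem cartanForm_apply (θ : L →ₗ[ℝ] L) (X Y : L) :
    cartanForm θ X Y = -killingForm ℝ L X (θ Y) := rfl

namespace IsCartanInvolution

theorem cartanForm_pos (hθ : IsCartanInvolution θ) {X : L} (hX : X ≠ 0) : 0 < cartanForm θ X X :=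
  hθ.pos X hX

theorem killingForm_map (hθ : IsCartanInvolution θ) (X Y : L) :
    killingForm ℝ L (θ X) (θ Y) = killingForm ℝ L X Y := by
  let e : L ≃ₗ⁅ℝ⁆ L :=
    { θ with
      map_lie' := fun {X Y} ↦ hθ.map_lie X Y
      invFun := θ
      left_inv := hθ.involutive
      right_inv := hθ.involutive }
  exact LieAlgebra.killingForm_of_equiv_apply e X Y

theorem cartanForm_symm (hθ : IsCartanInvolution θ) (X Y : L) :
    cartanForm θ X Y = cartanForm θ Y X := by
  rw [cartanForm_apply, cartanForm_apply, ← hθ.killingForm_map, hθ.involutive]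
  congr 1
  exact LieModule.traceForm_comm ℝ L L _ _

/-- Invariance of the Killing form makes `-ad (θ X)` the adjoint of `ad X`; hence `ad X` is
symmetric for `X ∈ 𝔭`. -/
theorem cartanForm_lie (hθ : IsCartanInvolution θ) (X Y Z : L) :
    cartanForm θ ⁅X, Y⁆ Z = -cartanForm θ Y ⁅θ X, Z⁆ := by
  rw [cartanForm_apply, cartanForm_apply, hθ.map_lie, hθ.involutive, neg_neg,
    ← lie_skew, map_neg, LinearMap.neg_apply, neg_neg]
  exact LieModule.traceForm_apply_lie_apply ℝ L L Y X (θ Z)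

theorem isKilling (hθ : IsCartanInvolution θ) : LieAlgebra.IsKilling ℝ L where
  killingCompl_top_eq_bot := by
    refine (LieSubmodule.eq_bot_iff _).2 fun X hX ↦ ?_
    by_contra h
    have h₁ := hθ.pos X h
    rw [LieIdeal.mem_killingCompl] at hX
    have h₂ := hX (θ X) (by simp)
    have h₃ : killingForm ℝ L X (θ X) = 0 := (LieModule.traceForm_comm ℝ L L _ _).trans h₂
    rw [h₃, neg_zero] at h₁
    exact lt_irrefl _ h₁

variable [FiniteDimensional ℝ L]

theorem eq_zero_of_lie_eq_zero (hθ : IsCartanInvolution θ) {X : L} (h : ∀ Y : L, ⁅X, Y⁆ = 0) :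
    X = 0 := by
  have := hθ.isKilling
  refine (LieDerivation.IsKilling.ad_apply_eq_zero_iff ℝ L X).1 ?_
  ext Y
  simpa using h Y

theorem exists_eigenbasis_ad (hθ : IsCartanInvolution θ) {X : L} (hX : θ X = -X) :
    ∃ (b : Basis (Fin (finrank ℝ L)) ℝ L) (μ : Fin (finrank ℝ L) → ℝ),
      (∀ i j, cartanForm θ (b i) (b j) = if i = j then 1 else 0) ∧
        ∀ i, ⁅X, b i⁆ = μ i • b i := by
  refine exists_orthonormal_eigenbasis (cartanForm θ) hθ.cartanForm_symm
    (fun X hX ↦ hθ.cartanForm_pos hX) (LieAlgebra.ad ℝ L X) fun Y Z ↦ ?_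
  rw [LieAlgebra.ad_apply, LieAlgebra.ad_apply, hθ.cartanForm_lie, hX, neg_lie, map_neg, neg_neg]

/-- The operator `A` acts as `e^{ad X}` on the eigenvectors of `ad X`. -/
def _root_.IsExpAd (X : L) (A : L →ₗ[ℝ] L) : Prop :=
  ∀ (v : L) (μ : ℝ), ⁅X, v⁆ = μ • v → A v = Real.exp μ • v

variable {A : L →ₗ[ℝ] L}

theorem symmetric_of_isExpAd (hθ : IsCartanInvolution θ) {X : L} (hX : θ X = -X)
    (hA : IsExpAd X A) (Y Z : L) : cartanForm θ (A Y) Z = cartanForm θ Y (A Z) := by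
  obtain ⟨b, μ, hb, hμ⟩ := hθ.exists_eigenbasis_ad hX
  exact symmetric_of_eigenbasis _ b hb (fun i ↦ hA _ _ (hμ i)) Y Z

theorem map_lie_of_isExpAd (hθ : IsCartanInvolution θ) {X : L} (hX : θ X = -X)
    (hA : IsExpAd X A) (Y Z : L) : A ⁅Y, Z⁆ = ⁅A Y, A Z⁆ := by
  obtain ⟨b, μ, hb, hμ⟩ := hθ.exists_eigenbasis_ad hX
  let ad : L →ₗ[ℝ] L →ₗ[ℝ] L := (LieAlgebra.ad ℝ L : L →ₗ[ℝ] Module.End ℝ L)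
  have h : ad.compr₂ A = ad.compl₁₂ A A := by
    refine LinearMap.ext_basis b b fun i j ↦ ?_
    change A ⁅b i, b j⁆ = ⁅A (b i), A (b j)⁆
    rw [hA _ _ (hμ i), hA _ _ (hμ j), hA _ (μ i + μ j), Real.exp_add, smul_lie, lie_smul, smul_smul]
    rw [leibniz_lie, hμ, hμ, smul_lie, lie_smul, add_smul]
  exact congrArg (fun F : L →ₗ[ℝ] L →ₗ[ℝ] L ↦ F Y Z) h

/-- The real exponential is injective on eigenvalues, so `ad X` and `ad Y` are both the logarithm of
`A`; and `ad` is faithful. -/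
theorem eq_of_isExpAd (hθ : IsCartanInvolution θ) {X Y : L} (hX : θ X = -X) (hY : θ Y = -Y)
    (hAX : IsExpAd X A) (hAY : IsExpAd Y A) : X = Y := by
  obtain ⟨b, μ, -, hμ⟩ := hθ.exists_eigenbasis_ad hX
  obtain ⟨c, ν, -, hν⟩ := hθ.exists_eigenbasis_ad hY
  have h : LieAlgebra.ad ℝ L X = LieAlgebra.ad ℝ L Y := by
    refine b.ext fun i ↦ ?_
    rw [LieAlgebra.ad_apply, hμ]
    refine (apply_eq_smul_of_eigenbasis c (fun j ↦ hAY _ _ (hν j)) (T := LieAlgebra.ad ℝ L Y)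
      (fun j ↦ hν j) (hAX _ _ (hμ i)) fun j hj ↦ Real.exp_injective hj).symm
  refine sub_eq_zero.1 (hθ.eq_zero_of_lie_eq_zero fun Z ↦ ?_)
  rw [sub_lie, sub_eq_zero]
  exact congrArg (fun F : Module.End ℝ L ↦ F Z) h

/-- A symmetric positive automorphism of the Lie algebra is `e^{ad Z}` with `Z ∈ 𝔭`. -/
theorem exists_isExpAd (hθ : IsCartanInvolution θ)
    (hs : ∀ X Y, cartanForm θ (A X) Y = cartanForm θ X (A Y))
    (hp : ∀ X, X ≠ 0 → 0 < cartanForm θ (A X) X) (hl : ∀ X Y, A ⁅X, Y⁆ = ⁅A X, A Y⁆) :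
    ∃ Z, θ Z = -Z ∧ ∀ A' : L →ₗ[ℝ] L, IsExpAd Z A' → A' = A := by
  have := hθ.isKilling
  obtain ⟨b, μ, hb, hμ⟩ := exists_orthonormal_eigenbasis (cartanForm θ) hθ.cartanForm_symm
    (fun X hX ↦ hθ.cartanForm_pos hX) A hs
  have hμpos (i) : 0 < μ i := by
    have h := hp (b i) (b.ne_zero i)
    rw [hμ, map_smul, LinearMap.smul_apply, hb, if_pos rfl] at h
    simpa using h
  let D : L →ₗ[ℝ] L := b.constr ℝ fun i ↦ Real.log (μ i) • b i
  have hD (i) : D (b i) = Real.log (μ i) • b i := b.constr_basis ℝ _ i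
  have hDA {v : L} {α : ℝ} (hv : A v = α • v) : D v = Real.log α • v :=
    apply_eq_smul_of_eigenbasis b hμ hD hv fun i hi ↦ by rw [hi]
  let ad : L →ₗ[ℝ] L →ₗ[ℝ] L := (LieAlgebra.ad ℝ L : L →ₗ[ℝ] Module.End ℝ L)
  -- As `A` is an automorphism, eigenvalues multiply under the bracket; their logarithms add, which
  -- is the Leibniz rule for `D = log A`.
  have hder : ad.compr₂ D = ad.compl₂ D + ad.comp D := by
    refine LinearMap.ext_basis b b fun i j ↦ ?_
    change D ⁅b i, b j⁆ = ⁅b i, D (b j)⁆ + ⁅D (b i), b j⁆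
    rw [hD, hD, hDA (α := μ i * μ j), Real.log_mul (hμpos i).ne' (hμpos j).ne', smul_lie, lie_smul,
      add_smul, add_comm]
    rw [hl, hμ, hμ, smul_lie, lie_smul, smul_smul]
  let D' : LieDerivation ℝ L L :=
    { D with
      leibniz' := fun X Y ↦ by
        have h := congrArg (fun F : L →ₗ[ℝ] L →ₗ[ℝ] L ↦ F X Y) hder
        change D ⁅X, Y⁆ = ⁅X, D Y⁆ + ⁅D X, Y⁆ at h
        change D ⁅X, Y⁆ = ⁅X, D Y⁆ - ⁅Y, D X⁆
        rw [h, ← lie_skew Y, sub_neg_eq_add] }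
  obtain ⟨Z, hZ⟩ := LieDerivation.IsKilling.exists_eq_ad D'
  have hZD (X : L) : ⁅Z, X⁆ = D X := by
    have h := congrArg (fun F : LieDerivation ℝ L L ↦ F X) hZ
    simpa using! h
  refine ⟨Z, ?_, fun A' hA' ↦ b.ext fun i ↦ ?_⟩
  -- Symmetry of `D = ad Z` says `ad Z = -ad (θ Z)`, so each `⁅Z + θ Z, W⁆` has zero length for
  -- `B_θ`.
  · have h : Z + θ Z = 0 := by
      refine hθ.eq_zero_of_lie_eq_zero fun W ↦ ?_
      by_contra hne
      have hpos := hθ.cartanForm_pos hne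
      have hDs := symmetric_of_eigenbasis _ b hb hD ⁅Z + θ Z, W⁆ W
      rw [← hZD, ← hZD, hθ.cartanForm_lie] at hDs
      rw [add_lie, map_add, ← add_lie, ← hDs, neg_add_cancel] at hpos
      exact lt_irrefl _ hpos
    exact eq_neg_of_add_eq_zero_right h
  · rw [hA' (b i) (Real.log (μ i)) (by rw [hZD, hD]), Real.exp_log (hμpos i), hμ]

/-- On `𝔭` the form is `tr (ad Z)² = ∑ μᵢ²`, and `μ² ≤ 2 e^{|μ|}`. The bound depends only on `e^{ad
Z}` and its inverse, which keeps logarithms of a convergent family in a compact set. -/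
theorem cartanForm_self_le_of_isExpAd (hθ : IsCartanInvolution θ) {Z : L} (hZ : θ Z = -Z)
    {A' : L →ₗ[ℝ] L} (hA : IsExpAd Z A) (hA' : IsExpAd (-Z) A') :
    cartanForm θ Z Z ≤ 2 * (LinearMap.trace ℝ L A + LinearMap.trace ℝ L A') := by
  obtain ⟨b, μ, -, hμ⟩ := hθ.exists_eigenbasis_ad hZ
  have h₁ : LinearMap.trace ℝ L A = ∑ i, Real.exp (μ i) :=
    trace_of_eigenbasis b fun i ↦ hA _ _ (hμ i)
  have h₂ : LinearMap.trace ℝ L A' = ∑ i, Real.exp (-μ i) :=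
    trace_of_eigenbasis b fun i ↦ hA' _ _ (by rw [neg_lie, hμ, neg_smul])
  have h₃ : cartanForm θ Z Z = ∑ i, μ i * μ i := by
    rw [cartanForm_apply, hZ, map_neg, neg_neg, killingForm, LieModule.traceForm_apply_apply]
    exact trace_of_eigenbasis b fun i ↦ by
      change ⁅Z, ⁅Z, b i⁆⁆ = _
      rw [hμ, lie_smul, hμ, smul_smul]
  rw [h₁, h₂, h₃, ← Finset.sum_add_distrib, Finset.mul_sum]
  refine Finset.sum_le_sum fun i _ ↦ ?_
  have h₄ := Real.quadratic_le_exp_of_nonneg (abs_nonneg (μ i))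
  have h₅ : Real.exp |μ i| ≤ Real.exp (μ i) + Real.exp (-μ i) := by
    rcases abs_choice (μ i) with h | h <;> rw [h]
    · exact le_add_of_nonneg_right (Real.exp_pos _).le
    · exact le_add_of_nonneg_left (Real.exp_pos _).le
  nlinarith [abs_nonneg (μ i), abs_mul_abs_self (μ i)]

end IsCartanInvolution

end CartanInvolution

/-! ### Cluster points and frontiers -/

section Topology

open Set Filter Topology

theorem MapClusterPt.eq_of_tendsto {X α : Type*} [TopologicalSpace X] [T2Space X] {l : Filter α}
    {u : α → X} {x y : X} (hx : MapClusterPt x l u) (hy : Tendsto u l (𝓝 y)) : x = y :=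
  eq_of_nhds_neBot (NeBot.mono hx (inf_le_inf_left _ hy))

theorem IsPreconnected.inter_frontier_nonempty {X : Type*} [TopologicalSpace X] {s t : Set X}
    (hs : IsPreconnected s) (h₁ : (s ∩ t).Nonempty) (h₂ : (s ∩ tᶜ).Nonempty) :
    (s ∩ frontier t).Nonempty := by
  by_contra h
  rw [not_nonempty_iff_eq_empty, eq_empty_iff_forall_notMem] at h
  have hi {x} (hx : x ∈ s) (hxt : x ∈ t) : x ∈ interior t := by
    by_contra hxi
    exact h x ⟨hx, subset_closure hxt, hxi⟩
  have hc {x} (hx : x ∈ s) (hxt : x ∉ t) : x ∈ (closure t)ᶜ := fun hxc ↦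
    h x ⟨hx, hxc, fun hxi ↦ hxt (interior_subset hxi)⟩
  obtain ⟨x, -, hxi, hxc⟩ := hs (interior t) (closure t)ᶜ isOpen_interior
    isClosed_closure.isOpen_compl
    (fun x hx ↦ (em (x ∈ t)).imp (hi hx) (hc hx))
    (h₁.imp fun x hx ↦ ⟨hx.1, hi hx.1 hx.2⟩) (h₂.imp fun x hx ↦ ⟨hx.1, hc hx.1 hx.2⟩)
  exact hxc (subset_closure (interior_subset hxi))

end Topology

/-! ### Continuity of `exp`, and lifting from `Ad` to the group -/

section AdjointPair

open Module Set Filter Topology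

variable {L : Type*} [LieRing L] [LieAlgebra ℝ L] [TopologicalSpace L]
  {G : Type*} [Group G] [TopologicalSpace G]

/-- An exponential map together with an adjoint representation. -/
structure IsAdjointPair (exp : L → G) (Ad : G →* Module.End ℝ L) : Prop where
  exp_add_smul : ∀ (X : L) (s t : ℝ), exp ((s + t) • X) = exp (s • X) * exp (t • X)
  continuous_exp_smul : ∀ X : L, Continuous fun t : ℝ ↦ exp (t • X)
  continuous_ad : ∀ v : L, Continuous fun g ↦ Ad g v
  continuous_ad_exp : ∀ v : L, Continuous fun X ↦ Ad (exp X) v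
  exists_injOn : ∃ U ∈ 𝓝 (1 : G), InjOn Ad U
  isExpAd : ∀ X : L, IsExpAd X (Ad (exp X))

namespace IsAdjointPair

variable {exp : L → G} {Ad : G →* Module.End ℝ L}

theorem exp_zero (h : IsAdjointPair exp Ad) : exp 0 = 1 := by
  have := h.exp_add_smul 0 0 0
  simpa using this

theorem exp_neg (h : IsAdjointPair exp Ad) (X : L) : exp (-X) = (exp X)⁻¹ := by
  have := h.exp_add_smul X (-1) 1
  rw [neg_add_cancel, zero_smul, h.exp_zero, one_smul, neg_one_smul] at this
  exact eq_inv_of_mul_eq_one_left this.symm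

theorem exp_nat_smul (h : IsAdjointPair exp Ad) (n : ℕ) (X : L) :
    exp ((n : ℝ) • X) = exp X ^ n := by
  induction n with
  | zero => simp [h.exp_zero]
  | succ n ih => rw [Nat.cast_succ, h.exp_add_smul, ih, one_smul, pow_succ]

theorem continuous_trace_ad [IsTopologicalAddGroup L] [ContinuousSMul ℝ L] [T2Space L]
    [FiniteDimensional ℝ L] (h : IsAdjointPair exp Ad) :
    Continuous fun g ↦ LinearMap.trace ℝ L (Ad g) := by
  let b := Module.finBasis ℝ L
  simp_rw [LinearMap.trace_eq_matrix_trace ℝ b, Matrix.trace, Matrix.diag_apply,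
    LinearMap.toMatrix_apply]
  refine continuous_finsetSum _ fun i _ ↦ ?_
  exact (LinearMap.continuous_of_finiteDimensional (b.coord i)).comp (h.continuous_ad (b i))

theorem exp_injOn [FiniteDimensional ℝ L] {θ : L →ₗ[ℝ] L} (h : IsAdjointPair exp Ad)
    (hθ : IsCartanInvolution θ) {X Y : L} (hX : θ X = -X) (hY : θ Y = -Y) (hXY : exp X = exp Y) : X = Y :=
  hθ.eq_of_isExpAd hX hY (h.isExpAd X) (hXY ▸ h.isExpAd Y)

variable [ContinuousSMul ℝ L] [T2Space L] [T2Space G] [LocallyCompactSpace G]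

/-- Near `0`, `exp` takes values in a compact `K` on which `Ad` is injective: a path `exp (t X)`
leaving `K` would meet its frontier, whose image under `Ad` stays away from `Ad 1`. In `K` a cluster
point is determined by its image under `Ad`, and `Ad ∘ exp` is continuous. -/
theorem eventually_continuousAt_exp (h : IsAdjointPair exp Ad) :
    ∀ᶠ X in 𝓝 (0 : L), ContinuousAt exp X := by
  obtain ⟨U, hU, hinj⟩ := h.exists_injOn
  obtain ⟨K, hK, hKU, hKc⟩ := local_compact_nhds hU
  let f : G → L → L := fun g v ↦ Ad g v
  have hf : Continuous f := continuous_pi h.continuous_ad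
  have hfe : Continuous fun X ↦ f (exp X) := continuous_pi h.continuous_ad_exp
  have hfinj {g g' : G} (hg : g ∈ K) (hg' : g' ∈ K) (hgg : f g = f g') : g = g' :=
    hinj (hKU hg) (hKU hg') (LinearMap.ext fun v ↦ congrFun hgg v)
  have h1K : (1 : G) ∈ interior K := mem_interior_iff_mem_nhds.2 hK
  have hfr : IsCompact (frontier K) := hKc.of_isClosed_subset isClosed_frontier
    (hKc.isClosed.frontier_subset)
  have hO : IsOpen (f '' frontier K)ᶜ := (hfr.image hf).isClosed.isOpen_compl
  have h1O : f 1 ∈ (f '' frontier K)ᶜ := by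
    rintro ⟨g, hg, hg1⟩
    have := hfinj (hKc.isClosed.frontier_subset hg) (interior_subset h1K) hg1
    rw [this] at hg
    exact hg.2 h1K
  have hW : (fun X ↦ f (exp X)) ⁻¹' (f '' frontier K)ᶜ ∈ 𝓝 (0 : L) :=
    (hO.preimage hfe).mem_nhds (by rw [mem_preimage, h.exp_zero]; exact h1O)
  -- Balanced, so that the whole segment from `0` to `X` stays in `V`.
  obtain ⟨V, ⟨hV, hVb⟩, hVW⟩ := (nhds_basis_balanced ℝ L).mem_iff.1 hW
  have hVK {X : L} (hX : X ∈ V) : exp X ∈ K := by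
    have hpre : IsPreconnected ((fun t : ℝ ↦ exp (t • X)) '' Icc 0 1) :=
      isPreconnected_Icc.image _ (h.continuous_exp_smul X).continuousOn
    by_contra hXK
    obtain ⟨g, ⟨t, ht, rfl⟩, hg⟩ := hpre.inter_frontier_nonempty (t := K)
      ⟨1, ⟨0, by simp, by simp [h.exp_zero]⟩, interior_subset h1K⟩
      ⟨exp X, ⟨1, by simp, by simp⟩, hXK⟩
    have htX : t • X ∈ V := hVb.smul_mem (by
      rw [Real.norm_eq_abs, abs_of_nonneg ht.1]; exact ht.2) hX
    exact hVW htX ⟨_, hg, rfl⟩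
  filter_upwards [eventually_mem_nhds_iff.2 hV] with X hX
  refine hKc.tendsto_nhds_of_unique_mapClusterPt (mem_of_superset hX fun Y hY ↦ hVK hY)
    fun g hg hcl ↦ hfinj hg (hVK (mem_of_mem_nhds hX)) ?_
  exact (hcl.continuousAt_comp hf.continuousAt).eq_of_tendsto hfe.continuousAt

variable [IsTopologicalGroup G]

/-- Continuity near `0` spreads everywhere through `exp Y = exp (Y / (n + 1)) ^ (n + 1)`. -/
theorem continuous_exp (h : IsAdjointPair exp Ad) : Continuous exp := by
  refine continuous_iff_continuousAt.2 fun X ↦ ?_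
  have ht : Tendsto (fun n : ℕ ↦ ((n : ℝ) + 1)⁻¹ • X) atTop (𝓝 0) := by
    have := (tendsto_one_div_add_atTop_nhds_zero_nat (𝕜 := ℝ)).smul_const X
    simpa using this
  obtain ⟨n, hn⟩ := (ht.eventually h.eventually_continuousAt_exp).exists
  have he : exp = fun Y ↦ exp (((n : ℝ) + 1)⁻¹ • Y) ^ (n + 1) := by
    funext Y
    rw [← h.exp_nat_smul, Nat.cast_succ, smul_smul, mul_inv_cancel₀ (by positivity), one_smul]
  rw [he]
  exact (ContinuousAt.comp (g := exp) (f := fun Y : L ↦ ((n : ℝ) + 1)⁻¹ • Y) hn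
    (by fun_prop)).pow _

end IsAdjointPair

theorem IsCartanInvolution.exists_isCompact_cartanForm_le [IsTopologicalAddGroup L]
    [ContinuousSMul ℝ L] [FiniteDimensional ℝ L] {θ : L →ₗ[ℝ] L} (hθ : IsCartanInvolution θ)
    (M : ℝ) : ∃ K : Set L, IsCompact K ∧ ∀ X, cartanForm θ X X ≤ M → X ∈ K := by
  -- With `X = 0` this merely supplies a `B_θ`-orthonormal basis.
  obtain ⟨b, -, hb, -⟩ := hθ.exists_eigenbasis_ad (X := 0) (by simp)
  have hcoord (X : L) (i) : cartanForm θ (b i) X = b.repr X i := by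
    have h : cartanForm θ (b i) = b.coord i := b.ext fun j ↦ by
      rw [hb, b.coord_apply, b.repr_self, Finsupp.single_apply]
      simp [eq_comm]
    rw [h, b.coord_apply]
  have hself (X : L) : cartanForm θ X X = ∑ i, b.repr X i * b.repr X i := by
    have h : cartanForm θ X X = cartanForm θ X (∑ i, b.repr X i • b i) := by rw [b.sum_repr]
    rw [h, map_sum]
    refine Finset.sum_congr rfl fun i _ ↦ ?_
    rw [map_smul, hθ.cartanForm_symm, hcoord, smul_eq_mul]
  refine ⟨b.equivFun.symm '' Set.pi univ fun _ ↦ Icc (-(|M| + 1)) (|M| + 1),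
    (isCompact_univ_pi fun _ ↦ isCompact_Icc).image
      (show Continuous b.equivFun.symm.toLinearMap from
        LinearMap.continuous_of_finiteDimensional _), fun X hX ↦ ?_⟩
  refine ⟨b.equivFun X, fun i _ ↦ ?_, b.equivFun.symm_apply_apply X⟩
  rw [b.equivFun_apply, mem_Icc, ← abs_le]
  have h₁ : b.repr X i * b.repr X i ≤ M := by
    rw [hself] at hX
    exact (Finset.single_le_sum (f := fun i ↦ b.repr X i * b.repr X i)
      (fun i _ ↦ mul_self_nonneg _) (Finset.mem_univ i)).trans hX
  have h₂ := le_abs_self M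
  have h₃ := abs_nonneg M
  refine abs_le_of_sq_le_sq ?_ (by positivity)
  nlinarith

namespace IsAdjointPair

variable {exp : L → G} {Ad : G →* Module.End ℝ L}

variable [IsTopologicalAddGroup L] [ContinuousSMul ℝ L] [T2Space L]
  [IsTopologicalGroup G] [T2Space G] [LocallyCompactSpace G]
variable [FiniteDimensional ℝ L] {θ : L →ₗ[ℝ] L}

/-- The logarithms `Z t` of `Ad (g t)` are locally bounded and unique, hence continuous in `t`. Then
`(exp (Z t))⁻¹ * g t` is a continuous path in the discrete kernel of `Ad` starting at `1`. -/
theorem exists_exp_eq_of_continuous (h : IsAdjointPair exp Ad) (hθ : IsCartanInvolution θ)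
    {g : ℝ → G} (hg : Continuous g) (h0 : ∃ X, θ X = -X ∧ exp X = g 0)
    (hAd : ∀ t, ∃ X, θ X = -X ∧ Ad (exp X) = Ad (g t)) (t : ℝ) :
    ∃ X, θ X = -X ∧ exp X = g t := by
  choose Z hZθ hZ using hAd
  have huniq {X Y : L} (hX : θ X = -X) (hY : θ Y = -Y) (hXY : Ad (exp X) = Ad (exp Y)) : X = Y :=
    hθ.eq_of_isExpAd hX hY (h.isExpAd X) (hXY ▸ h.isExpAd Y)
  have hθc : Continuous θ := LinearMap.continuous_of_finiteDimensional θ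
  have hZc : Continuous Z := by
    refine continuous_iff_continuousAt.2 fun t₀ ↦ ?_
    let c : ℝ → ℝ := fun t ↦ 2 * (LinearMap.trace ℝ L (Ad (g t)) + LinearMap.trace ℝ L (Ad (g t)⁻¹))
    have hc : Continuous c := ((h.continuous_trace_ad.comp hg).add
      (h.continuous_trace_ad.comp hg.inv)).const_smul (2 : ℝ)
    have hZle (t) : cartanForm θ (Z t) (Z t) ≤ c t := by
      refine hθ.cartanForm_self_le_of_isExpAd (hZθ t) (hZ t ▸ h.isExpAd (Z t)) ?_
      have h₁ : Ad (g t)⁻¹ = Ad (exp (-Z t)) := by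
        refine left_inv_eq_right_inv (a := Ad (g t)) ?_ ?_
        · rw [← map_mul, inv_mul_cancel, map_one]
        · rw [← hZ, ← map_mul, h.exp_neg, mul_inv_cancel, map_one]
      rw [h₁]
      exact h.isExpAd _
    obtain ⟨K, hK, hKm⟩ := hθ.exists_isCompact_cartanForm_le (c t₀ + 1)
    refine (hK.inter_right (isClosed_eq hθc continuous_neg)).tendsto_nhds_of_unique_mapClusterPt
      ?_ ?_
    · filter_upwards [hc.continuousAt.eventually (gt_mem_nhds (lt_add_one (c t₀)))] with s hs
      exact ⟨hKm _ ((hZle s).trans hs.le), hZθ s⟩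
    · rintro X ⟨-, hX⟩ hcl
      refine huniq hX (hZθ t₀) (LinearMap.ext fun v ↦ ?_)
      have h₁ := hcl.continuousAt_comp (h.continuous_ad_exp v).continuousAt
      refine h₁.eq_of_tendsto ?_
      simp only [Function.comp_def, hZ]
      exact ((h.continuous_ad v).comp hg).continuousAt
  let z : ℝ → G := fun t ↦ (exp (Z t))⁻¹ * g t
  have hzc : Continuous z := (h.continuous_exp.comp hZc).inv.mul hg
  have hzAd (t) : Ad (z t) = 1 := by
    rw [map_mul, ← hZ, ← map_mul, inv_mul_cancel, map_one]
  obtain ⟨U, hU, hinj⟩ := h.exists_injOn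
  -- Openness is local injectivity of `Ad` at `1`, since `Ad (z t) = 1` throughout.
  have hclopen : IsClopen {t | z t = 1} := by
    refine ⟨isClosed_eq hzc continuous_const, isOpen_iff_mem_nhds.2 fun t ht ↦ ?_⟩
    have hUt : U ∈ 𝓝 (z t) := by rw [ht]; exact hU
    filter_upwards [hzc.continuousAt.eventually hUt] with s hs
    exact hinj hs (mem_of_mem_nhds hU) ((hzAd s).trans (map_one Ad).symm)
  have h0z : z 0 = 1 := by
    obtain ⟨X, hX, hXg⟩ := h0
    have : Z 0 = X := huniq (hZθ 0) hX (by rw [hZ, hXg])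
    simp only [z]
    rw [this, hXg, inv_mul_cancel]
  have huniv := hclopen.eq_univ ⟨0, h0z⟩
  have hzt : z t = 1 := (huniv ▸ mem_univ t : t ∈ {t | z t = 1})
  exact ⟨Z t, hZθ t, inv_mul_eq_one.1 hzt⟩

theorem exists_exp_eq_mul_mul (h : IsAdjointPair exp Ad) (hθ : IsCartanInvolution θ) {X Y : L}
    (hX : θ X = -X) (hY : θ Y = -Y) : ∃ Z, θ Z = -Z ∧ exp Z = exp X * exp Y * exp X := by
  let g : ℝ → G := fun t ↦ exp X * exp (t • Y) * exp X
  have hg : Continuous g := (continuous_const.mul (h.continuous_exp_smul Y)).mul continuous_const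
  suffices hAd : ∀ t, ∃ W, θ W = -W ∧ Ad (exp W) = Ad (g t) by
    -- The path starts in `P`, at `exp X * exp X = exp (2 X)`.
    have h1 := h.exists_exp_eq_of_continuous hθ hg ⟨(1 + 1 : ℝ) • X, by simp [hX], by
      rw [h.exp_add_smul]; simp [g, h.exp_zero]⟩ hAd 1
    simpa [g] using h1
  intro t
  have hYt (s : ℝ) : θ (s • Y) = -(s • Y) := by rw [map_smul, hY, smul_neg]
  have hsymm {W : L} (hW : θ W = -W) := hθ.symmetric_of_isExpAd hW (h.isExpAd W)
  have hlie {W : L} (hW : θ W = -W) := hθ.map_lie_of_isExpAd hW (h.isExpAd W)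
  have hgA (t : ℝ) (v : L) : Ad (g t) v = Ad (exp X) (Ad (exp (t • Y)) (Ad (exp X) v)) := by
    simp only [g, map_mul]
    rfl
  have hs (V W : L) : cartanForm θ (Ad (g t) V) W = cartanForm θ V (Ad (g t) W) := by
    rw [hgA, hgA, hsymm hX, hsymm (hYt t), hsymm hX]
  have hl (V W : L) : Ad (g t) ⁅V, W⁆ = ⁅Ad (g t) V, Ad (g t) W⁆ := by
    rw [hgA, hgA, hgA, hlie hX, hlie (hYt t), hlie hX]
  have hp (V : L) (hV : V ≠ 0) : 0 < cartanForm θ (Ad (g t) V) V := by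
    -- Halving `t Y` writes `Ad (g t)` as `TᵀT` with `T = Ad (exp (t Y / 2) * exp X)` invertible,
    -- hence positive definite.
    have hhalf : exp (t • Y) = exp ((t / 2) • Y) * exp ((t / 2) • Y) := by
      rw [← h.exp_add_smul, add_halves]
    have hA : Ad (g t) V =
        Ad (exp X) (Ad (exp ((t / 2) • Y)) (Ad (exp ((t / 2) • Y) * exp X) V)) := by
      rw [hgA, hhalf, map_mul, map_mul]
      rfl
    have hA' : Ad (exp ((t / 2) • Y)) (Ad (exp X) V) = Ad (exp ((t / 2) • Y) * exp X) V := by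
      rw [map_mul]
      rfl
    rw [hA, hsymm hX, hsymm (hYt _), hA']
    refine hθ.cartanForm_pos (X := Ad (exp ((t / 2) • Y) * exp X) V) fun h0 ↦ hV ?_
    have h₁ : Ad ((exp ((t / 2) • Y) * exp X)⁻¹ * (exp ((t / 2) • Y) * exp X)) V = 0 := by
      rw [map_mul]
      change Ad _ (Ad _ V) = 0
      rw [h0, map_zero]
    rw [inv_mul_cancel, map_one] at h₁
    exact h₁
  obtain ⟨Z, hZ, hZA⟩ := hθ.exists_isExpAd hs hp hl
  exact ⟨Z, hZ, hZA _ (h.isExpAd Z)⟩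

end IsAdjointPair

end AdjointPair

/-! ### Powers, means and Riccati equations in `P` -/

section SymmetricSpaceOfLieGroup

open Set Filter Topology

variable {E : Type*} [NormedAddCommGroup E] [NormedSpace ℝ E] [FiniteDimensional ℝ E]
  [CompleteSpace E]
  {G : Type*} [TopologicalSpace G] [ChartedSpace E G] [Group G] [LieGroup 𝓘(ℝ, E) ∞ G]
  [T2Space G] {Θ : G →* G}

/-- The adjoint representation by linear endomorphisms of the Lie algebra. -/
noncomputable def adjointEnd (E : Type*) [NormedAddCommGroup E] [NormedSpace ℝ E] [CompleteSpace E]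
    (G : Type*) [TopologicalSpace G] [ChartedSpace E G] [Group G] [LieGroup 𝓘(ℝ, E) ∞ G] :
    G →* Module.End ℝ (GroupLieAlgebra 𝓘(ℝ, E) G) where
  toFun g := (adjointRep E G g : E →ₗ[ℝ] E)
  map_one' := by rw [map_one]; rfl
  map_mul' g h := by rw [map_mul]; rfl

omit [FiniteDimensional ℝ E] [CompleteSpace E] [T2Space G] in
theorem continuous_adjointRep_apply (v : E) : Continuous fun g : G ↦ adjointRep E G g v :=
  continuous_adjointRep.clm_apply continuous_const

omit [FiniteDimensional ℝ E] in
theorem continuous_adjointRep_lieExp_apply (v : E) :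
    Continuous fun X : GroupLieAlgebra 𝓘(ℝ, E) G ↦ adjointRep E G (lieExp X) v :=
  continuous_adjointRep_lieExp.clm_apply continuous_const

namespace IsGroupCartanInvolution

theorem isAdjointPair (hΘ : IsGroupCartanInvolution E Θ) :
    IsAdjointPair (lieExp (E := E) (G := G)) (adjointEnd E G) where
  exp_add_smul := lieExp_add_smul
  continuous_exp_smul := continuous_lieExp_smul
  continuous_ad v := continuous_adjointRep_apply (E := E) v
  continuous_ad_exp v := continuous_adjointRep_lieExp_apply (E := E) v
  exists_injOn := by
    have : FiniteDimensional ℝ (GroupLieAlgebra 𝓘(ℝ, E) G) := inferInstanceAs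
      (FiniteDimensional ℝ E)
    obtain ⟨U, hU, hinj⟩ := exists_injOn_adjointRep (E := E) (G := G)
      fun X hX ↦ hΘ.differential.eq_zero_of_lie_eq_zero hX
    refine ⟨U, hU, fun g hg g' hg' h ↦ hinj hg hg' ?_⟩
    exact ContinuousLinearMap.coe_injective (M₁ := E) (M₂ := E) h
  isExpAd X v μ h := adjointRep_lieExp_apply_of_lie_eq_smul (E := E) h

omit [FiniteDimensional ℝ E] [CompleteSpace E] [LieGroup 𝓘(ℝ, E) ∞ G] [T2Space G] in
theorem _root_.mem_cartanSubspace {X : GroupLieAlgebra 𝓘(ℝ, E) G} :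
    X ∈ cartanSubspace E Θ ↔ lieDifferential E Θ X = -X := by
  rw [cartanSubspace, Module.End.mem_eigenspace_iff, neg_one_smul]

theorem injOn_lieExp (hΘ : IsGroupCartanInvolution E Θ) :
    InjOn (lieExp (E := E) (G := G)) (cartanSubspace E Θ) := by
  have : FiniteDimensional ℝ (GroupLieAlgebra 𝓘(ℝ, E) G) := inferInstanceAs
      (FiniteDimensional ℝ E)
  exact fun X hX Y hY h ↦ hΘ.isAdjointPair.exp_injOn hΘ.differential (mem_cartanSubspace.1 hX)
    (mem_cartanSubspace.1 hY) h

theorem mul_mul_mem (hΘ : IsGroupCartanInvolution E Θ) {p q : G}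
    (hp : p ∈ symmetricSpaceP E Θ) (hq : q ∈ symmetricSpaceP E Θ) :
    p * q * p ∈ symmetricSpaceP E Θ := by
  have : FiniteDimensional ℝ (GroupLieAlgebra 𝓘(ℝ, E) G) := inferInstanceAs
      (FiniteDimensional ℝ E)
  have : IsTopologicalAddGroup (GroupLieAlgebra 𝓘(ℝ, E) G) := inferInstanceAs
      (IsTopologicalAddGroup E)
  have : ContinuousSMul ℝ (GroupLieAlgebra 𝓘(ℝ, E) G) := inferInstanceAs
      (ContinuousSMul ℝ E)
  have : T2Space (GroupLieAlgebra 𝓘(ℝ, E) G) := inferInstanceAs (T2Space E)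
  have : IsTopologicalGroup G := topologicalGroup_of_lieGroup 𝓘(ℝ, E) ∞
  have : LocallyCompactSpace G := Manifold.locallyCompact_of_finiteDimensional 𝓘(ℝ, E)
  obtain ⟨X, hX, rfl⟩ := hp
  obtain ⟨Y, hY, rfl⟩ := hq
  obtain ⟨Z, hZ, h⟩ := hΘ.isAdjointPair.exists_exp_eq_mul_mul hΘ.differential
    (mem_cartanSubspace.1 hX) (mem_cartanSubspace.1 hY)
  exact ⟨Z, mem_cartanSubspace.2 hZ, h⟩

theorem logP_lieExp (hΘ : IsGroupCartanInvolution E Θ) {X : GroupLieAlgebra 𝓘(ℝ, E) G}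
    (hX : X ∈ cartanSubspace E Θ) : logP E Θ (lieExp X) = X :=
  hΘ.injOn_lieExp.leftInvOn_invFunOn hX

theorem powP_lieExp (hΘ : IsGroupCartanInvolution E Θ) {X : GroupLieAlgebra 𝓘(ℝ, E) G}
    (hX : X ∈ cartanSubspace E Θ) (r : ℝ) : powP E Θ (lieExp X) r = lieExp (r • X) := by
  rw [powP, hΘ.logP_lieExp hX]

variable {p q : G}

theorem powP_mem (hΘ : IsGroupCartanInvolution E Θ) (hp : p ∈ symmetricSpaceP E Θ) (r : ℝ) :
    powP E Θ p r ∈ symmetricSpaceP E Θ := by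
  obtain ⟨X, hX, rfl⟩ := hp
  exact ⟨r • X, Submodule.smul_mem _ r hX, (hΘ.powP_lieExp hX r).symm⟩

theorem powP_one (hΘ : IsGroupCartanInvolution E Θ) (hp : p ∈ symmetricSpaceP E Θ) :
    powP E Θ p 1 = p := by
  obtain ⟨X, hX, rfl⟩ := hp
  rw [hΘ.powP_lieExp hX, one_smul]

omit [FiniteDimensional ℝ E] in
theorem powP_add (p : G) (r s : ℝ) : powP E Θ p (r + s) = powP E Θ p r * powP E Θ p s :=
  lieExp_add_smul _ r s

omit [FiniteDimensional ℝ E] in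
theorem powP_zero (p : G) : powP E Θ p 0 = 1 := by
  rw [powP, zero_smul, lieExp_zero]

omit [FiniteDimensional ℝ E] in
theorem powP_neg (p : G) (r : ℝ) : powP E Θ p (-r) = (powP E Θ p r)⁻¹ := by
  refine eq_inv_of_mul_eq_one_left ?_
  rw [← powP_add, neg_add_cancel, powP_zero]

theorem powP_powP (hΘ : IsGroupCartanInvolution E Θ) (hp : p ∈ symmetricSpaceP E Θ) (r s : ℝ) :
    powP E Θ (powP E Θ p r) s = powP E Θ p (s * r) := by
  obtain ⟨X, hX, rfl⟩ := hp
  rw [hΘ.powP_lieExp hX, hΘ.powP_lieExp (Submodule.smul_mem _ r hX), hΘ.powP_lieExp hX, smul_smul]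

theorem inv_eq_powP (hΘ : IsGroupCartanInvolution E Θ) (hp : p ∈ symmetricSpaceP E Θ) :
    p⁻¹ = powP E Θ p (-1) := by
  rw [powP_neg, hΘ.powP_one hp]

theorem inv_mem (hΘ : IsGroupCartanInvolution E Θ) (hp : p ∈ symmetricSpaceP E Θ) :
    p⁻¹ ∈ symmetricSpaceP E Θ := by
  rw [hΘ.inv_eq_powP hp]
  exact hΘ.powP_mem hp _

theorem powP_inv (hΘ : IsGroupCartanInvolution E Θ) (hp : p ∈ symmetricSpaceP E Θ) (r : ℝ) :
    powP E Θ p⁻¹ r = (powP E Θ p r)⁻¹ := by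
  rw [hΘ.inv_eq_powP hp, hΘ.powP_powP hp, mul_neg_one, powP_neg]

theorem powP_half_mul_self (hΘ : IsGroupCartanInvolution E Θ) (hp : p ∈ symmetricSpaceP E Θ) :
    powP E Θ p (1 / 2) * powP E Θ p (1 / 2) = p := by
  rw [← powP_add, add_halves, hΘ.powP_one hp]

theorem powP_half_mul_self_eq (hΘ : IsGroupCartanInvolution E Θ) (hp : p ∈ symmetricSpaceP E Θ) :
    powP E Θ (p * p) (1 / 2) = p := by
  have h : p * p = powP E Θ p 2 := by
    rw [← one_add_one_eq_two, powP_add, hΘ.powP_one hp]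
  rw [h, hΘ.powP_powP hp]
  norm_num
  exact hΘ.powP_one hp

theorem map_eq_inv (hΘ : IsGroupCartanInvolution E Θ) (hp : p ∈ symmetricSpaceP E Θ) :
    Θ p = p⁻¹ := by
  obtain ⟨X, hX, rfl⟩ := hp
  rw [map_lieExp hΘ.smooth, mem_cartanSubspace.1 hX]
  exact hΘ.isAdjointPair.exp_neg X

/-- The solution in `P` of the Riccati equation `x p x = q` is unique. -/
theorem eq_of_mul_mul_eq (hΘ : IsGroupCartanInvolution E Θ) (hp : p ∈ symmetricSpaceP E Θ)
    {x y : G} (hx : x ∈ symmetricSpaceP E Θ) (hy : y ∈ symmetricSpaceP E Θ)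
    (h : x * p * x = y * p * y) : x = y := by
  set a := powP E Θ p (1 / 2) with ha
  have haP : a ∈ symmetricSpaceP E Θ := hΘ.powP_mem hp _
  have haa : a * a = p := hΘ.powP_half_mul_self hp
  -- Conjugating by `a = p^{1/2}` turns the Riccati equation into an equation of squares, and square
  -- roots in `P` are unique.
  have key : (a * x * a) * (a * x * a) = (a * y * a) * (a * y * a) := by
    calc (a * x * a) * (a * x * a) = a * (x * (a * a) * x) * a := by group
      _ = a * (y * (a * a) * y) * a := by rw [haa, h]
      _ = _ := by group
  have h₁ := congrArg (fun g ↦ powP E Θ g (1 / 2)) key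
  simp only [hΘ.powP_half_mul_self_eq (hΘ.mul_mul_mem haP hx),
    hΘ.powP_half_mul_self_eq (hΘ.mul_mul_mem haP hy)] at h₁
  exact mul_left_cancel (mul_right_cancel h₁)

theorem geometricMean_inv_mem (hΘ : IsGroupCartanInvolution E Θ) (hp : p ∈ symmetricSpaceP E Θ)
    (hq : q ∈ symmetricSpaceP E Θ) (t : ℝ) :
    geometricMean E Θ t p⁻¹ q ∈ symmetricSpaceP E Θ :=
  hΘ.mul_mul_mem (hΘ.powP_mem (hΘ.inv_mem hp) _) (hΘ.powP_mem (hΘ.mul_mul_mem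
    (hΘ.powP_mem (hΘ.inv_mem hp) _) hq) _)

/-- `p⁻¹ ♯ q` solves the Riccati equation `x p x = q`. -/
theorem geometricMean_inv_mul_mul (hΘ : IsGroupCartanInvolution E Θ)
    (hp : p ∈ symmetricSpaceP E Θ) (hq : q ∈ symmetricSpaceP E Θ) :
    geometricMean E Θ (1 / 2) p⁻¹ q * p * geometricMean E Θ (1 / 2) p⁻¹ q = q := by
  unfold geometricMean
  rw [powP_neg, hΘ.powP_inv hp, inv_inv]
  set a := powP E Θ p (1 / 2) with ha
  have haP : a ∈ symmetricSpaceP E Θ := hΘ.powP_mem hp _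
  set w := powP E Θ (a * q * a) (1 / 2) with hw
  have hww : w * w = a * q * a := hΘ.powP_half_mul_self (hΘ.mul_mul_mem haP hq)
  have haa : a * a = p := hΘ.powP_half_mul_self hp
  calc a⁻¹ * w * a⁻¹ * p * (a⁻¹ * w * a⁻¹) = a⁻¹ * w * a⁻¹ * (a * a) * (a⁻¹ * w * a⁻¹) := by
        rw [haa]
    _ = a⁻¹ * (w * w) * a⁻¹ := by group
    _ = q := by rw [hww]; group

/-- Inverting `s p s = q` shows that `s⁻¹` solves `x q x = p`, whose solution in `P` is unique. -/
theorem geometricMean_inv_comm (hΘ : IsGroupCartanInvolution E Θ)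
    (hp : p ∈ symmetricSpaceP E Θ) (hq : q ∈ symmetricSpaceP E Θ) :
    geometricMean E Θ (1 / 2) q⁻¹ p = (geometricMean E Θ (1 / 2) p⁻¹ q)⁻¹ := by
  refine hΘ.eq_of_mul_mul_eq hq (hΘ.geometricMean_inv_mem hq hp _)
    (hΘ.inv_mem (hΘ.geometricMean_inv_mem hp hq _)) ?_
  rw [hΘ.geometricMean_inv_mul_mul hq hp]
  set s := geometricMean E Θ (1 / 2) p⁻¹ q with hs
  have h : s * p * s = q := hΘ.geometricMean_inv_mul_mul hp hq
  calc p = s⁻¹ * (s * p * s) * s⁻¹ := by group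
    _ = _ := by rw [h]

end IsGroupCartanInvolution

end SymmetricSpaceOfLieGroup

/-! ### Geometric mean against spectral means -/

theorem mainTheorem10 {E : Type*} [NormedAddCommGroup E] [NormedSpace ℝ E]
    [FiniteDimensional ℝ E] [CompleteSpace E]
    {G : Type*} [TopologicalSpace G] [ChartedSpace E G] [Group G] [LieGroup 𝓘(ℝ, E) ∞ G]
    [T2Space G] [ConnectedSpace G] [NoncompactSpace G]
    [LieAlgebra.IsSemisimple ℝ (GroupLieAlgebra 𝓘(ℝ, E) G)]
    (Θ : G →* G) (hΘ : IsGroupCartanInvolution E Θ)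
    (p q : G) (hp : p ∈ symmetricSpaceP E Θ) (hq : q ∈ symmetricSpaceP E Θ)
    (t : ℝ) (ht : t ∈ Set.Icc (0 : ℝ) 1) :
    ∃ k ∈ fixedSubgroup Θ,
      IsPConjugate E Θ (geometricMean E Θ (1 / 2) p q)
        (powP E Θ (spectralMean E Θ t q p) (1 / 2) * k *
          powP E Θ (spectralMean E Θ t p q) (1 / 2)) := by
  have hsP := hΘ.geometricMean_inv_mem hp hq (1 / 2)
  have hsp := hΘ.geometricMean_inv_mul_mul hp hq
  have hMq : spectralMean E Θ t q p ∈ symmetricSpaceP E Θ :=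
    hΘ.mul_mul_mem (hΘ.powP_mem (hΘ.geometricMean_inv_mem hq hp _) _) hq
  have hMp : spectralMean E Θ t p q ∈ symmetricSpaceP E Θ :=
    hΘ.mul_mul_mem (hΘ.powP_mem hsP _) hp
  have hbb := hΘ.powP_half_mul_self hMq
  have haa := hΘ.powP_half_mul_self hMp
  have hΘb := hΘ.map_eq_inv (hΘ.powP_mem hMq (1 / 2))
  have hΘa := hΘ.map_eq_inv (hΘ.powP_mem hMp (1 / 2))
  set b := powP E Θ (spectralMean E Θ t q p) (1 / 2)
  set a := powP E Θ (spectralMean E Θ t p q) (1 / 2)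
  rw [spectralMean, hΘ.geometricMean_inv_comm hp hq, hΘ.powP_inv hsP] at hbb
  rw [spectralMean] at haa
  set s := geometricMean E Θ (1 / 2) p⁻¹ q
  have hΘc := hΘ.map_eq_inv (hΘ.powP_mem hsP t)
  have hcP := hΘ.powP_mem hsP t
  set c := powP E Θ s t
  -- Reading `p` as `(p⁻¹)⁻¹` makes the facts on `p⁻¹ ♯ q` available for `p ♯ q`.
  have hpi : p⁻¹⁻¹ = p := inv_inv p
  have hmP : geometricMean E Θ (1 / 2) p q ∈ symmetricSpaceP E Θ := by
    rw [← hpi]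
    exact hΘ.geometricMean_inv_mem (hΘ.inv_mem hp) hq _
  have hm : geometricMean E Θ (1 / 2) p q * p⁻¹ * geometricMean E Θ (1 / 2) p q = q := by
    have := hΘ.geometricMean_inv_mul_mul (hΘ.inv_mem hp) hq
    rwa [hpi] at this
  have hΘm := hΘ.map_eq_inv hmP
  set m := geometricMean E Θ (1 / 2) p q
  -- With the conjugator `c = s^t`, the equation `m = c b k a c⁻¹` forces this `k`; only `Θ k = k`
  -- remains.
  refine ⟨b⁻¹ * (c⁻¹ * m * c) * a⁻¹, ?_, c, hcP, by group⟩
  change Θ (b⁻¹ * (c⁻¹ * m * c) * a⁻¹) = b⁻¹ * (c⁻¹ * m * c) * a⁻¹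
  simp only [map_mul, map_inv, hΘb, hΘa, hΘc, hΘm, inv_inv]
  calc b * (c * m⁻¹ * c⁻¹) * a = b⁻¹ * (b * b) * (c * m⁻¹ * c⁻¹) * a := by group
    _ = b⁻¹ * c⁻¹ * (m * p⁻¹ * m) * m⁻¹ * c⁻¹ * a := by rw [hbb, hm]; group
    _ = b⁻¹ * (c⁻¹ * m * c) * (c * p * c)⁻¹ * a := by group
    _ = b⁻¹ * (c⁻¹ * m * c) * a⁻¹ := by rw [← haa]; group
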